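/- Let $\mathcal E$ be a Euclidean affine space with (finite-dimensional) translation vector space $\mathcal V$, and let $\varPi$ be a Bieberbach group in $\mathcal E$, that is, a torsion-free discrete subgroup of $\mathrm{Iso}\,\mathcal E$ having a compact fundamental domain (a compact set meeting every orbit). Let $L=\varPi\cap\mathcal V$ be its lattice subgroup (all the translations in $\varPi$) and $H\subseteq\mathrm{Iso}\,\mathcal V$ its holonomy group (the linear parts of all the elements of $\varPi$), so that there is a short exact sequence $L\to\varPi\to H$. Write $\mathrm{pr}:\mathcal E\to\mathcal M=\mathcal E/\varPi$ for the projection onto the corresponding compact flat Riemannian manifold. Let $\mathcal V'$ be a nonzero proper vector subspace of $\mathcal V$ which is $H$-invariant and is an $L$-subspace, meaning that it is spanned by $L\cap\mathcal V'$. Then the following holds. (i) The affine subspaces of $\mathcal E$ of dimension $\dim\mathcal V'$ parallel to $\mathcal V'$ (the cosets of $\mathcal V'$) are the leaves of a foliation $F_{\mathcal E}$ on $\mathcal E$. It is projectable, under the locally isometric covering projections $\mathrm{pr}:\mathcal E\to\mathcal M$ and $\mathcal E\to\mathcal T=\mathcal E/L$, onto foliations $F_{\mathcal M}$ of $\mathcal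 M$ and $F_{\mathcal T}$ of the torus $\mathcal T$; that is, the differentials of the projections map the tangent distribution of $F_{\mathcal E}$ onto those of $F_{\mathcal M}$ and $F_{\mathcal T}$. Both $F_{\mathcal M}$ and $F_{\mathcal T}$ have compact totally geodesic leaves, tangent to a parallel distribution. (ii) The leaves $\mathcal M'$ of $F_{\mathcal M}$ coincide with the $\mathrm{pr}$-images of the leaves $\mathcal E'$ of $F_{\mathcal E}$, and the restrictions $\mathrm{pr}:\mathcal E'\to\mathcal M'$ are (locally isometric) covering projections. The same is true with $\mathcal M$ and $\mathrm{pr}$ replaced by $\mathcal T$ and the projection $\mathcal E\to\mathcal T$. Given a leaf $\mathcal E'$ of $F_{\mathcal E}$ and the leaf $\mathcal M'=\mathrm{pr}(\mathcal E')$ of $F_{\mathcal M}$, there is a Bieberbach group $\varPi'$ in the Euclidean affine space $\mathcal E'$ corresponding to $\mathcal M'$, in the sense that $\mathrm{pr}:\mathcal E'\to\mathcal M'$ descends to an isometry $\mathcal E'/\varPi'\to\mathcal M'$. For any such $\varPi'$, with the lattice subgroup $L'$ and the holonomy group $H'$ of $\varPi'$, and with $\varSigma'$ denoting the stabilizer of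 $\mathcal E'$ in $\varPi$ (all the elements of $\varPi$ mapping $\mathcal E'$ onto itself): (a) $\varPi'$ consists of the restrictions to $\mathcal E'$ of all the elements of $\varSigma'$; (b) $H'$ is formed by the restrictions to $\mathcal V'$ of the linear parts of the elements of $\varSigma'$; (c) $L'=\varPi'\cap\mathcal V'$, and $L\cap\mathcal V'\subseteq L'$. (iii) The restriction homomorphism $\varSigma'\to\varPi'$ is an isomorphism. -/

import Mathlib

open Set Filter Topology MulAction Manifold
open scoped ContDiff Pointwise

/-! ## Isometries of a Euclidean affine space and Bieberbach groups

`P` is a Euclidean affine space (a metric torsor) over the finite-dimensional real inner product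
space `V`; its isometry group is the group `P ≃ᵃⁱ[ℝ] P` of affine isometries. -/

noncomputable section Groups

variable {V P : Type*} [NormedAddCommGroup V] [InnerProductSpace ℝ V]
  [MetricSpace P] [NormedAddTorsor V P]

/-- The tautological action of the isometry group. -/
instance isoMulAction : MulAction (P ≃ᵃⁱ[ℝ] P) P where
  smul g x := g x
  one_smul _ := rfl
  mul_smul _ _ _ := rfl

theorem iso_smul_def (g : P ≃ᵃⁱ[ℝ] P) (x : P) : g • x = g x := rfl

/-- The topology of the isometry group is that of pointwise convergence (for isometries it is the
same as the compact-open topology). -/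
instance isoTopology : TopologicalSpace (P ≃ᵃⁱ[ℝ] P) :=
  TopologicalSpace.induced (fun g : P ≃ᵃⁱ[ℝ] P => (g : P → P)) inferInstance

/-- Torsion-free discrete groups of isometries. -/
class IsTorsionFreeDiscrete (Γ : Subgroup (P ≃ᵃⁱ[ℝ] P)) : Prop where
  discrete : DiscreteTopology Γ
  torsionFree : ∀ γ ∈ Γ, IsOfFinOrder γ → γ = 1

/-- A Bieberbach group: a torsion-free discrete group of isometries which has a compact
fundamental domain, that is, a compact set meeting all the orbits. -/
class IsBieberbach (Γ : Subgroup (P ≃ᵃⁱ[ℝ] P)) : Prop extends IsTorsionFreeDiscrete Γ where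
  cocompact : ∃ K : Set P, IsCompact K ∧ ∀ x, ∃ γ ∈ Γ, γ x ∈ K

/-- The linear-part homomorphism. -/
def linearPart : (P ≃ᵃⁱ[ℝ] P) →* (V ≃ₗᵢ[ℝ] V) where
  toFun g := g.linearIsometryEquiv
  map_one' := rfl
  map_mul' _ _ := rfl

/-- The lattice subgroup `L = Π ∩ V`: all the vectors whose translation lies in `Π`. -/
def latticeSubgroup (Γ : Subgroup (P ≃ᵃⁱ[ℝ] P)) : AddSubgroup V where
  carrier := {v | AffineIsometryEquiv.constVAdd ℝ P v ∈ Γ}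
  zero_mem' := by
    have h : AffineIsometryEquiv.constVAdd ℝ P (0 : V) = 1 := AffineIsometryEquiv.constVAdd_zero
    simp only [mem_ofPred_eq, h, one_mem]
  add_mem' {v w} hv hw := by
    have h : AffineIsometryEquiv.constVAdd ℝ P (v + w)
        = AffineIsometryEquiv.constVAdd ℝ P v * AffineIsometryEquiv.constVAdd ℝ P w := by
      ext x; simp [add_vadd]
    simp only [mem_ofPred_eq, h]
    exact mul_mem hv hw
  neg_mem' {v} hv := by
    have h : AffineIsometryEquiv.constVAdd ℝ P (-v)
        = (AffineIsometryEquiv.constVAdd ℝ P v)⁻¹ := by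
      rw [eq_inv_iff_mul_eq_one]
      ext x; simp
    simp only [mem_ofPred_eq, h]
    exact inv_mem hv

/-- The same lattice `L`, as a subgroup of the isometry group: all the translations in `Π`. -/
def translationSubgroup (Γ : Subgroup (P ≃ᵃⁱ[ℝ] P)) : Subgroup (P ≃ᵃⁱ[ℝ] P) where
  carrier := {g | ∃ v ∈ latticeSubgroup Γ, g = AffineIsometryEquiv.constVAdd ℝ P v}
  one_mem' := ⟨0, zero_mem _, by ext x; simp⟩
  mul_mem' := by
    rintro _ _ ⟨v, hv, rfl⟩ ⟨w, hw, rfl⟩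
    exact ⟨v + w, add_mem hv hw, by ext x; simp [add_vadd]⟩
  inv_mem' := by
    rintro _ ⟨v, hv, rfl⟩
    refine ⟨-v, neg_mem hv, ?_⟩
    rw [inv_eq_iff_mul_eq_one]
    ext x; simp

theorem translationSubgroup_le (Γ : Subgroup (P ≃ᵃⁱ[ℝ] P)) : translationSubgroup Γ ≤ Γ := by
  rintro _ ⟨v, hv, rfl⟩
  exact hv

/-- The holonomy group: the linear parts of all the elements of `Π`. -/
def holonomyGroup (Γ : Subgroup (P ≃ᵃⁱ[ℝ] P)) : Subgroup (V ≃ₗᵢ[ℝ] V) :=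
  Γ.map linearPart

/-- Invariance of a vector subspace under a group of linear isometries. -/
def IsInvariantSubspace (H : Subgroup (V ≃ₗᵢ[ℝ] V)) (W : Submodule ℝ V) : Prop :=
  ∀ A ∈ H, ∀ v ∈ W, A v ∈ W

/-- An `L`-subspace: a vector subspace `W` spanned by `L ∩ W`. -/
def IsLatticeSubspace (L : AddSubgroup V) (W : Submodule ℝ V) : Prop :=
  Submodule.span ℝ ((L : Set V) ∩ W) = W

/-- The stabilizer in `Π` of a subset of the affine space: all the elements of `Π` mapping it onto
itself. -/
def stabilizerIn (Γ : Subgroup (P ≃ᵃⁱ[ℝ] P)) (S : Set P) : Subgroup (P ≃ᵃⁱ[ℝ] P) where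
  carrier := {γ | γ ∈ Γ ∧ γ '' S = S}
  one_mem' := ⟨one_mem _, by simp⟩
  mul_mem' := by
    rintro a b ⟨ha, ha'⟩ ⟨hb, hb'⟩
    exact ⟨mul_mem ha hb, by rw [AffineIsometryEquiv.coe_mul, image_comp, hb', ha']⟩
  inv_mem' := by
    rintro a ⟨ha, ha'⟩
    refine ⟨inv_mem ha, ?_⟩
    conv_lhs => rw [← ha']
    rw [← image_comp, ← AffineIsometryEquiv.coe_mul, inv_mul_cancel]
    simp

instance (Γ : Subgroup (P ≃ᵃⁱ[ℝ] P)) : ContinuousConstSMul Γ P :=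
  ⟨fun γ => (γ : P ≃ᵃⁱ[ℝ] P).continuous⟩

theorem IsTorsionFreeDiscrete.mono {Γ Γ' : Subgroup (P ≃ᵃⁱ[ℝ] P)} (h : IsTorsionFreeDiscrete Γ)
    (hle : Γ' ≤ Γ) : IsTorsionFreeDiscrete Γ' where
  discrete := by
    have := h.discrete
    exact DiscreteTopology.of_subset (s := (Γ : Set (P ≃ᵃⁱ[ℝ] P))) this hle
  torsionFree γ hγ := h.torsionFree γ (hle hγ)

instance (Γ : Subgroup (P ≃ᵃⁱ[ℝ] P)) [h : IsTorsionFreeDiscrete Γ] :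
    IsTorsionFreeDiscrete (translationSubgroup Γ) :=
  h.mono (translationSubgroup_le Γ)

/-- A discrete group of isometries is separated from the identity on some finite set. -/
theorem exists_finset_of_discrete (Γ : Subgroup (P ≃ᵃⁱ[ℝ] P)) (h : DiscreteTopology Γ) :
    ∃ F : Finset P, ∃ ε > 0, ∀ γ ∈ Γ, (∀ x ∈ F, dist (γ x) x < ε) → γ = 1 := by
  have h1 : ({1} : Set Γ) ∈ 𝓝 (1 : Γ) := by
    rw [nhds_discrete]; exact mem_pure.2 rfl
  rw [nhds_induced, mem_comap] at h1
  obtain ⟨t, ht, hts⟩ := h1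
  rw [nhds_induced, mem_comap] at ht
  obtain ⟨u, hu, hut⟩ := ht
  rw [nhds_pi, mem_pi'] at hu
  obtain ⟨F, r, hr, hru⟩ := hu
  have hr' : ∀ x : P, ∃ ε > 0, Metric.ball x ε ⊆ r x := fun x => by
    have := hr x
    exact Metric.mem_nhds_iff.1 this
  choose ε hε hεr using hr'
  obtain ⟨δ, hδ, hδF⟩ : ∃ δ > 0, ∀ x ∈ F, δ ≤ ε x := by
    rcases F.eq_empty_or_nonempty with rfl | hF
    · exact ⟨1, one_pos, by simp⟩
    · obtain ⟨x, hx, hmin⟩ := F.exists_min_image ε hF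
      exact ⟨ε x, hε x, hmin⟩
  refine ⟨F, δ, hδ, fun γ hγ hF => ?_⟩
  have : (⟨γ, hγ⟩ : Γ) ∈ ({1} : Set Γ) := by
    refine hts (hut (hru ?_))
    intro x hx
    exact hεr x ((hF x hx).trans_le (hδF x hx))
  exact congrArg Subtype.val (mem_singleton_iff.1 this)

variable [FiniteDimensional ℝ V]

instance (priority := low) affineProperSpace : ProperSpace P := by
  have o : P := Classical.arbitrary P
  refine ⟨fun x r => ?_⟩
  have : ProperSpace V := FiniteDimensional.proper ℝ V
  have h := (isCompact_closedBall (o -ᵥ o : V) (dist x o + r)).image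
    (Homeomorph.vaddConst o).continuous
  refine h.of_isClosed_subset Metric.isClosed_closedBall ?_
  intro y hy
  refine ⟨y -ᵥ o, ?_, by simp⟩
  simp only [Metric.mem_closedBall, vsub_self, dist_zero_right] at hy ⊢
  rw [← dist_eq_norm_vsub]
  linarith [dist_triangle y x o]

instance (Γ : Subgroup (P ≃ᵃⁱ[ℝ] P)) [h : IsTorsionFreeDiscrete Γ] :
    ProperlyDiscontinuousSMul Γ P := by
  obtain ⟨F, ε, hε, hF⟩ := exists_finset_of_discrete Γ h.discrete
  refine ⟨fun {K L} hK hL => ?_⟩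
  by_contra hinf
  set A : Set Γ := {γ : Γ | ((γ • ·) '' K ∩ L).Nonempty} with hA
  have hinf' : A.Infinite := hinf
  obtain ⟨γ₀, hγ₀⟩ := hinf'.nonempty
  obtain ⟨_, ⟨k₀, hk₀, _⟩, hl₀⟩ := hγ₀
  obtain ⟨RK, hRK⟩ := hK.isBounded.subset_closedBall k₀
  obtain ⟨RL, hRL⟩ := hL.isBounded.subset_closedBall k₀
  let Φ : Γ → (F → P) := fun γ x => (γ : P ≃ᵃⁱ[ℝ] P) x
  have key : ∀ γ γ' : Γ, (∀ x : F, dist (Φ γ x) (Φ γ' x) < ε) → γ = γ' := by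
    intro γ γ' hd
    have h1 : ((γ'⁻¹ * γ : Γ) : P ≃ᵃⁱ[ℝ] P) = 1 := by
      refine hF _ (γ'⁻¹ * γ : Γ).2 fun x hx => ?_
      have h2 := hd ⟨x, hx⟩
      have h3 : dist (((γ'⁻¹ * γ : Γ) : P ≃ᵃⁱ[ℝ] P) x) x
          = dist ((γ : P ≃ᵃⁱ[ℝ] P) x) ((γ' : P ≃ᵃⁱ[ℝ] P) x) := by
        rw [← (γ' : P ≃ᵃⁱ[ℝ] P).dist_map]
        simp
      rw [h3]; exact h2
    have h2 : γ'⁻¹ * γ = 1 := Subtype.ext h1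
    exact (inv_mul_eq_one.1 h2).symm
  have hinj : Function.Injective Φ := fun γ γ' he => key γ γ' fun x => by
    rw [he, dist_self]; exact hε
  have hcomp : IsCompact (Set.pi univ fun x : F => Metric.closedBall k₀ (RL + (RK + dist k₀ x))) :=
    isCompact_univ_pi fun x => isCompact_closedBall _ _
  have hsub : Φ '' A ⊆ Set.pi univ fun x : F => Metric.closedBall k₀ (RL + (RK + dist k₀ x)) := by
    rintro _ ⟨γ, ⟨_, ⟨k, hk, rfl⟩, hl⟩, rfl⟩ x -
    have h1 : dist ((γ : P ≃ᵃⁱ[ℝ] P) k) k₀ ≤ RL := hRL hl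
    have h2 : dist k k₀ ≤ RK := hRK hk
    have h3 : dist ((γ : P ≃ᵃⁱ[ℝ] P) x) ((γ : P ≃ᵃⁱ[ℝ] P) k) = dist (x : P) k :=
      (γ : P ≃ᵃⁱ[ℝ] P).dist_map _ _
    have h4 := dist_triangle ((γ : P ≃ᵃⁱ[ℝ] P) x) ((γ : P ≃ᵃⁱ[ℝ] P) k) k₀
    have h5 := dist_triangle (x : P) k₀ k
    rw [dist_comm k₀ k, dist_comm (x : P) k₀] at h5
    change dist ((γ : P ≃ᵃⁱ[ℝ] P) x) k₀ ≤ _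
    linarith
  obtain ⟨z, -, hz⟩ := (hinf'.image hinj.injOn).exists_accPt_of_subset_isCompact hcomp hsub
  rw [accPt_iff_frequently] at hz
  have hb : Metric.ball z (ε / 2) ∈ 𝓝 z := Metric.ball_mem_nhds _ (by linarith)
  obtain ⟨y, ⟨hyz, γ, hγ, rfl⟩, hy⟩ := (hz.and_eventually hb).exists
  have hb' : Metric.ball z (min (ε / 2) (dist (Φ γ) z)) ∈ 𝓝 z :=
    Metric.ball_mem_nhds _ (lt_min (by linarith) (dist_pos.2 hyz))
  obtain ⟨y', ⟨-, γ', hγ', rfl⟩, hy'⟩ := (hz.and_eventually hb').exists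
  have hy1 : dist (Φ γ) z < ε / 2 := hy
  have hy2 : dist (Φ γ') z < min (ε / 2) (dist (Φ γ) z) := hy'
  have : γ = γ' := key γ γ' fun x => by
    have h1 := dist_le_pi_dist (Φ γ) (Φ γ') x
    have h2 := dist_triangle_right (Φ γ) (Φ γ') z
    have h3 := hy2.trans_le (min_le_left _ _)
    linarith
  subst this
  exact lt_irrefl _ (hy2.trans_le (min_le_right _ _))

instance (Γ : Subgroup (P ≃ᵃⁱ[ℝ] P)) [h : IsTorsionFreeDiscrete Γ] : IsCancelSMul Γ P := by
  rw [isCancelSMul_iff_eq_one_of_smul_eq]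
  intro γ x hx
  have hfin := ProperlyDiscontinuousSMul.finite_disjoint_inter_image (Γ := Γ)
    (isCompact_singleton (x := x)) (isCompact_singleton (x := x))
  have hpow : ∀ n : ℕ, γ ^ n • x = x := fun n => by
    induction n with
    | zero => simp
    | succ n ih => rw [pow_succ, mul_smul, hx, ih]
  have hγ : IsOfFinOrder γ := by
    by_contra hno
    have hinj := injective_pow_iff_not_isOfFinOrder.2 hno
    refine Set.infinite_range_of_injective hinj (hfin.subset ?_)
    rintro _ ⟨n, rfl⟩
    exact ⟨x, ⟨x, rfl, hpow n⟩, rfl⟩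
  exact Subtype.ext (h.torsionFree γ γ.2 (Submonoid.isOfFinOrder_coe.2 hγ))

end Groups

/-! ## Flat Riemannian manifolds

A flat Riemannian manifold is a manifold with an atlas whose transition maps are locally
restrictions of Euclidean isometries; the Riemannian metric is the one for which the charts are
isometric, and its Levi-Civita connection is ordinary differentiation in these charts. -/

noncomputable section Flat

variable {V : Type*} [NormedAddCommGroup V] [InnerProductSpace ℝ V]

variable (V) in
/-- The pregroupoid of maps which near every point agree with a Euclidean isometry. -/
def euclideanPregroupoid : Pregroupoid V where
  property f u := ∀ x ∈ u, ∃ g : V ≃ᵃⁱ[ℝ] V, f =ᶠ[𝓝 x] g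
  comp {f g u v} hf hg _ _ _ x hx := by
    obtain ⟨a, ha⟩ := hf x hx.1
    obtain ⟨b, hb⟩ := hg (f x) hx.2
    refine ⟨b * a, ?_⟩
    have hc : Tendsto f (𝓝 x) (𝓝 (f x)) := by
      have h1 : Tendsto a (𝓝 x) (𝓝 (a x)) := a.continuous.continuousAt
      rw [ha.eq_of_nhds]
      exact h1.congr' ha.symm
    filter_upwards [ha, hc.eventually hb] with y hy1 hy2
    rw [Function.comp_apply, hy2, hy1]; rfl
  id_mem x _ := ⟨1, EventuallyEq.rfl⟩
  locality {f u} hu h x hx := by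
    obtain ⟨v, hv, hxv, h'⟩ := h x hx
    exact h' x ⟨hx, hxv⟩
  congr {f g u} hu hfg hf x hx := by
    obtain ⟨a, ha⟩ := hf x hx
    refine ⟨a, ?_⟩
    filter_upwards [ha, hu.mem_nhds hx] with y hy1 hy2
    rw [hfg y hy2, hy1]

variable (V) in
/-- The groupoid of local Euclidean isometries of `V`. -/
def euclideanGroupoid : StructureGroupoid V :=
  (euclideanPregroupoid V).groupoid

instance : ClosedUnderRestriction (euclideanGroupoid V) := by
  refine (closedUnderRestriction_iff_id_le _).2 (StructureGroupoid.le_iff.2 ?_)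
  rintro e ⟨s, hs, hes⟩
  refine (euclideanGroupoid V).mem_of_eqOnSource ?_ hes
  exact ⟨fun x _ => ⟨1, EventuallyEq.rfl⟩, fun x _ => ⟨1, EventuallyEq.rfl⟩⟩

variable (V) in
/-- The isometric charts of a flat Riemannian manifold. -/
def flatCharts (M : Type*) [TopologicalSpace M] [ChartedSpace V M] :
    Set (OpenPartialHomeomorph M V) :=
  (euclideanGroupoid V).maximalAtlas M

/-- The Riemannian metric of a flat Riemannian manifold. The tangent space at `x` is `V`, by means
of the isometric chart `chartAt V x`, and the inner product is that of `V`. -/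
def flatInner {M : Type*} [TopologicalSpace M] [ChartedSpace V M] {x : M}
    (v w : TangentSpace 𝓘(ℝ, V) x) : ℝ :=
  inner ℝ (show V from v) (show V from w)

variable {P : Type*} [MetricSpace P] [NormedAddTorsor V P]

/-- A Euclidean affine space as a flat manifold, with the single chart `x ↦ x - o`, where `o` is an
arbitrary origin. Thus all its tangent spaces are `V`. -/
instance (priority := 50) affineChartedSpace : ChartedSpace V P :=
  (Homeomorph.vaddConst (Classical.arbitrary P)).symm.toOpenPartialHomeomorph.singletonChartedSpace
    rfl

instance (priority := 50) affineHasGroupoid : HasGroupoid P (euclideanGroupoid V) :=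
  OpenPartialHomeomorph.singleton_hasGroupoid _ rfl _

variable [FiniteDimensional ℝ V]

/-- The flat manifold `E / Γ`: its charts are the local inverses of the projection, followed by the
chart of `E`; their transition maps are restrictions of elements of `Γ`. -/
instance quotientHasGroupoid (Γ : Subgroup (P ≃ᵃⁱ[ℝ] P)) [IsTorsionFreeDiscrete Γ] :
    HasGroupoid (orbitRel.Quotient Γ P) (euclideanGroupoid V) := by
  refine hasGroupoid_of_pregroupoid _ ?_
  rintro _ _ ⟨p, rfl⟩ ⟨q, rfl⟩ y hy
  generalize_proofs hl hr at hy ⊢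
  set a := hr.choose p
  set b := hr.choose q
  set o : P := Classical.arbitrary P
  set x₀ : P := y +ᵥ o
  have hx₀ : Quotient.mk (orbitRel Γ P) x₀ ∈ (hl.localInverseAt b).source := by
    have h := hy.2
    simp only [OpenPartialHomeomorph.trans_source, mem_preimage, mem_inter_iff] at h
    convert! h.1 using 1
    simp [OpenPartialHomeomorph.trans_symm_eq_symm_trans_symm]
    rfl
  set c : P := hl.localInverseAt b (Quotient.mk (orbitRel Γ P) x₀) with hc
  have hmk : Quotient.mk (orbitRel Γ P) c = Quotient.mk (orbitRel Γ P) x₀ :=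
    hl.apply_localInverseAt_of_mem hx₀
  obtain ⟨γ, hγ⟩ : c ∈ orbit Γ x₀ := Quotient.exact hmk
  have hγ' : (γ : P ≃ᵃⁱ[ℝ] P) x₀ = c := hγ
  refine ⟨((AffineIsometryEquiv.vaddConst ℝ o).trans (γ : P ≃ᵃⁱ[ℝ] P)).trans
    (AffineIsometryEquiv.vaddConst ℝ o).symm, ?_⟩
  have hcont : Continuous fun z : V => (γ : P ≃ᵃⁱ[ℝ] P) (z +ᵥ o) :=
    (γ : P ≃ᵃⁱ[ℝ] P).continuous.comp (Homeomorph.vaddConst o).continuous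
  have hev : ∀ᶠ z in 𝓝 y, (γ : P ≃ᵃⁱ[ℝ] P) (z +ᵥ o) ∈ (hl.localInverseAt b).target := by
    refine hcont.continuousAt.eventually ((hl.localInverseAt b).open_target.mem_nhds ?_)
    change (γ : P ≃ᵃⁱ[ℝ] P) x₀ ∈ _
    rw [hγ']
    exact (hl.localInverseAt b).map_source hx₀
  filter_upwards [hev] with z hz
  have h1 : Quotient.mk (orbitRel Γ P) ((γ : P ≃ᵃⁱ[ℝ] P) (z +ᵥ o))
      = Quotient.mk (orbitRel Γ P) (z +ᵥ o) :=
    Quotient.sound ⟨γ, rfl⟩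
  have h2 : hl.localInverseAt b (Quotient.mk (orbitRel Γ P) (z +ᵥ o))
      = (γ : P ≃ᵃⁱ[ℝ] P) (z +ᵥ o) := by
    rw [← h1]
    have := (hl.localInverseAt b).right_inv hz
    rwa [hl.localInverseAt_symm] at this
  have h3 : ∀ w : P, (chartAt V w : P → V) = fun x => x -ᵥ o := fun _ => rfl
  have h4 : ∀ w : P, ((chartAt V w).symm : V → P) = fun v => v +ᵥ o := fun _ => rfl
  simp only [OpenPartialHomeomorph.coe_trans, OpenPartialHomeomorph.trans_symm_eq_symm_trans_symm,
    Function.comp_apply, IsLocalHomeomorph.localInverseAt_symm, h3, h4]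
  rw [h2]
  rfl

/-- The local isometries of `V` are smooth, so that flat manifolds are smooth manifolds. -/
instance quotientIsManifold (Γ : Subgroup (P ≃ᵃⁱ[ℝ] P)) [IsTorsionFreeDiscrete Γ] :
    IsManifold 𝓘(ℝ, V) ∞ (orbitRel.Quotient Γ P) := by
  have key : ∀ (f : V → V) (s : Set V), (∀ x ∈ s, ∃ g : V ≃ᵃⁱ[ℝ] V, f =ᶠ[𝓝 x] g) →
      ContDiffOn ℝ ∞ f s := by
    intro f s h x hx
    obtain ⟨g, hg⟩ := h x hx
    have h1 : (g : V → V) = fun y => g.linearIsometryEquiv y + g 0 := by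
      funext y
      have := g.map_vadd 0 y
      simpa using this
    have h2 : ContDiff ℝ ∞ g := by
      rw [h1]
      exact g.linearIsometryEquiv.contDiff.add contDiff_const
    exact (h2.contDiffAt.congr_of_eventuallyEq hg).contDiffWithinAt
  refine isManifold_of_contDiffOn _ _ _ fun e e' he he' => ?_
  have h := (euclideanGroupoid V).compatible he he'
  simpa using key _ _ h.1

end Flat

/-! ## Distributions, submanifolds and leaves in flat Riemannian manifolds -/

noncomputable section Foliations

universe u v

variable {V : Type v} [NormedAddCommGroup V] [InnerProductSpace ℝ V]
  {M : Type u} [TopologicalSpace M] [ChartedSpace V M]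

variable (V M) in
/-- A field of tangent subspaces. The smooth ones of constant rank are the distributions; those
below are parallel, which includes smoothness. -/
abbrev TangentField := ∀ x : M, Submodule ℝ (TangentSpace 𝓘(ℝ, V) x)

/-- The differential at `x` of the chart `e`. -/
def chartDeriv (e : OpenPartialHomeomorph M V) (x : M) : TangentSpace 𝓘(ℝ, V) x →L[ℝ] V :=
  mfderiv 𝓘(ℝ, V) 𝓘(ℝ, V) e x

/-- The image of `D x` under the differential of the chart `e`. -/
def TangentField.inChart (D : TangentField V M) (e : OpenPartialHomeomorph M V) (x : M) :
    Submodule ℝ V :=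
  (D x).map (chartDeriv e x : TangentSpace 𝓘(ℝ, V) x →ₗ[ℝ] V)

/-- `D` is a parallel distribution (for the Levi-Civita connection): in every isometric chart, in
which covariant differentiation is ordinary differentiation, it is locally constant. -/
def TangentField.IsParallel (D : TangentField V M) : Prop :=
  ∀ e ∈ flatCharts V M, ∀ x ∈ e.source, ∀ᶠ y in 𝓝 x, D.inChart e y = D.inChart e x

/-- `D` is projectable under `f` onto `D'`: the differential of `f` at `x` maps `D x` onto
`D' (f x)`, for all `x`. -/
def TangentField.IsProjectable {M' : Type*} [TopologicalSpace M'] [ChartedSpace V M']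
    (D : TangentField V M) (f : M → M') (D' : TangentField V M') : Prop :=
  ∀ x, (D x).map (mfderiv 𝓘(ℝ, V) 𝓘(ℝ, V) f x :
    TangentSpace 𝓘(ℝ, V) x →ₗ[ℝ] TangentSpace 𝓘(ℝ, V) (f x)) = D' (f x)

variable (V M) in
/-- A submanifold (not necessarily carrying the subset topology): a smooth second countable
manifold with an injective immersion into `M`. -/
structure Submanifold where
  Pts : Type u
  dim : ℕ
  [top : TopologicalSpace Pts]
  [secondCountable : SecondCountableTopology Pts]
  [charted : ChartedSpace (EuclideanSpace ℝ (Fin dim)) Pts]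
  [smooth : IsManifold (𝓡 dim) ∞ Pts]
  incl : Pts → M
  incl_injective : Function.Injective incl
  incl_immersion : IsImmersion (𝓡 dim) 𝓘(ℝ, V) ∞ incl

attribute [instance] Submanifold.top Submanifold.secondCountable Submanifold.charted
  Submanifold.smooth

namespace Submanifold

variable (N : Submanifold V M)

/-- The differential of the inclusion. -/
def dincl (p : N.Pts) :
    TangentSpace (𝓡 N.dim) p →L[ℝ] TangentSpace 𝓘(ℝ, V) (N.incl p) :=
  mfderiv (𝓡 N.dim) 𝓘(ℝ, V) N.incl p

/-- The tangent space of the submanifold, as a subspace of that of `M`. -/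
def tangent (p : N.Pts) : Submodule ℝ (TangentSpace 𝓘(ℝ, V) (N.incl p)) :=
  LinearMap.range (N.dincl p : TangentSpace (𝓡 N.dim) p →ₗ[ℝ] TangentSpace 𝓘(ℝ, V) (N.incl p))

/-- The submanifold metric. -/
def metric {p : N.Pts} (a b : TangentSpace (𝓡 N.dim) p) : ℝ :=
  flatInner (N.dincl p a) (N.dincl p b)

/-- An integral manifold of `D`. -/
def IsIntegral (D : TangentField V M) : Prop :=
  ∀ p, N.tangent p = D (N.incl p)

/-- A leaf of `D`: a maximal connected integral manifold. -/
def IsLeaf (D : TangentField V M) : Prop :=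
  ConnectedSpace N.Pts ∧ N.IsIntegral D ∧
    ∀ N' : Submanifold V M, ConnectedSpace N'.Pts → N'.IsIntegral D →
      range N.incl ⊆ range N'.incl → range N'.incl = range N.incl

/-- Total geodesicity: every geodesic of `M` issuing from a point of `N` in a direction tangent to
`N` (in an isometric chart `e`, a straight line `t ↦ e p + t • a`) is near the initial point a
curve in `N`. -/
def IsTotallyGeodesic : Prop :=
  ∀ p : N.Pts, ∀ e ∈ flatCharts V M, N.incl p ∈ e.source →
    ∀ a ∈ (N.tangent p).map (chartDeriv e (N.incl p) : TangentSpace 𝓘(ℝ, V) (N.incl p) →ₗ[ℝ] V),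
    ∃ c : ℝ → N.Pts, c 0 = p ∧
      ∀ᶠ t in 𝓝 (0 : ℝ), ContinuousAt c t ∧ N.incl (c t) = e.symm (e (N.incl p) + t • a)

end Submanifold

/-- The leaves of `D`, as subsets of `M`. -/
def leafSets (D : TangentField V M) : Set (Set M) :=
  {S | ∃ N : Submanifold V M, N.IsLeaf D ∧ range N.incl = S}

/-- The leaves of `D` form a foliation: they are a partition of `M` into integral manifolds. -/
def IsFoliation (D : TangentField V M) : Prop :=
  ∀ x : M, ∃! S, S ∈ leafSets D ∧ x ∈ S

/-- A Riemannian covering projection: a smooth covering projection which is locally isometric. -/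
def IsRiemannianCovering {M' : Type*} [TopologicalSpace M'] [ChartedSpace V M']
    (f : M → M') : Prop :=
  IsCoveringMap f ∧ Function.Surjective f ∧ IsLocalDiffeomorph 𝓘(ℝ, V) 𝓘(ℝ, V) ∞ f ∧
    ∀ (x : M) (a b : TangentSpace 𝓘(ℝ, V) x),
      flatInner (mfderiv 𝓘(ℝ, V) 𝓘(ℝ, V) f x a) (mfderiv 𝓘(ℝ, V) 𝓘(ℝ, V) f x b) = flatInner a b

/-- The same for a mapping of a flat manifold `X` onto a submanifold of `M`. -/
def IsRiemannianCoveringOnto {W X : Type*} [NormedAddCommGroup W] [InnerProductSpace ℝ W]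
    [TopologicalSpace X] [ChartedSpace W X] (N : Submanifold V M) (f : X → N.Pts) : Prop :=
  IsCoveringMap f ∧ Function.Surjective f ∧ IsLocalDiffeomorph 𝓘(ℝ, W) (𝓡 N.dim) ∞ f ∧
    ∀ (x : X) (a b : TangentSpace 𝓘(ℝ, W) x),
      N.metric (mfderiv 𝓘(ℝ, W) (𝓡 N.dim) f x a) (mfderiv 𝓘(ℝ, W) (𝓡 N.dim) f x b)
        = flatInner a b

/-- An isometry (isometric diffeomorphism) between a flat manifold `X` and a submanifold of `M`. -/
def IsRiemannianIsometry {W X : Type*} [NormedAddCommGroup W] [InnerProductSpace ℝ W]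
    [TopologicalSpace X] [ChartedSpace W X] (N : Submanifold V M) (f : X → N.Pts) : Prop :=
  IsRiemannianCoveringOnto (W := W) N f ∧ Function.Injective f

end Foliations

noncomputable section Quotients

universe u v

variable {V : Type v} {P : Type u} [NormedAddCommGroup V] [InnerProductSpace ℝ V]
  [MetricSpace P] [NormedAddTorsor V P]

/-- The quotient `E / Γ`. -/
abbrev QuotientSpace (Γ : Subgroup (P ≃ᵃⁱ[ℝ] P)) : Type u := orbitRel.Quotient Γ P

/-- The projection `E → E / Γ`. -/
def quotientMap (Γ : Subgroup (P ≃ᵃⁱ[ℝ] P)) (x : P) : QuotientSpace Γ :=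
  Quotient.mk (orbitRel Γ P) x

variable (P) in
/-- The parallel distribution on the affine space `E` tangent to a vector subspace. -/
def constField (W : Submodule ℝ V) : TangentField V P := fun _ => W

/-- The affine subspaces of `E` parallel to `W`, of the same dimension (the cosets of `W`). -/
def IsCoset (W : Submodule ℝ V) (E' : AffineSubspace ℝ P) : Prop :=
  (E' : Set P).Nonempty ∧ E'.direction = W

variable [FiniteDimensional ℝ V]

/-- `Γ'`, a Bieberbach group in the affine subspace `E'`, corresponds to the submanifold `N` of
`E / Γ`: the restriction to `E'` of the projection `E → E / Γ` descends to an isometry between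
`E' / Γ'` and `N`. -/
def CorrespondsTo {Γ : Subgroup (P ≃ᵃⁱ[ℝ] P)} [IsTorsionFreeDiscrete Γ]
    (N : Submanifold V (QuotientSpace Γ)) (E' : AffineSubspace ℝ P) [Nonempty E']
    (Γ' : Subgroup (E' ≃ᵃⁱ[ℝ] E')) : Prop :=
  ∃ _ : IsBieberbach Γ', ∃ φ : QuotientSpace Γ' → N.Pts,
    IsRiemannianIsometry (W := E'.direction) N φ ∧
      ∀ x : E', N.incl (φ (quotientMap Γ' x)) = quotientMap Γ (x : P)

end Quotients

/-!
The idea is to treat `E`, the torus `E / L` and `M = E / Π` alike, as the targets of projections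
`pr : E → M` whose fibres are the orbits of a discrete group `Γ` of isometries preserving the
subspace `W`. In isometric charts `pr` is an isometry, and its differential at any point is the
linear part of an element of `Γ`, so that `W` descends to a parallel distribution on `M`. An
integral manifold of that distribution lifts, through a local inverse of `pr`, to a map into `E`
whose differentials all have the range `W`, and so it is locally the image of an open subset of a
coset of `W`. By connectedness its image is contained in the image of a single coset, and the leaves
are exactly the images of the cosets.

The restriction of `pr` to a coset `E'` is the quotient projection for the restrictions to `E'` of
the elements of `Γ` that preserve `E'`. These form a group acting freely, as a torsion-free discrete
group of isometries does, and it contains the translations by `L ∩ W`, which span `W`: hence the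
compactness of the leaves. Finally, a torsion-free discrete group of isometries is determined by its
orbits, by uniqueness of lifts, and so the Bieberbach group of a leaf is unique.
-/

universe u v

/-! ## Local diffeomorphisms and the inverse function theorem -/

section LocalDiffeomorph

variable {𝕜 E H F G M N : Type*} [NontriviallyNormedField 𝕜]
  [NormedAddCommGroup E] [NormedSpace 𝕜 E] [TopologicalSpace H]
  [NormedAddCommGroup F] [NormedSpace 𝕜 F] [TopologicalSpace G]
  {I : ModelWithCorners 𝕜 E H} {J : ModelWithCorners 𝕜 F G}
  [TopologicalSpace M] [ChartedSpace H M] [TopologicalSpace N] [ChartedSpace G N]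
  {n : WithTop ℕ∞}

theorem isLocalDiffeomorphAt_of_eqOn {f : M → N} {e : OpenPartialHomeomorph M N} {x : M}
    (he : ContMDiffOn I J n e e.source) (he_symm : ContMDiffOn J I n e.symm e.target)
    (hx : x ∈ e.source) (hf : EqOn f e e.source) : IsLocalDiffeomorphAt I J n f x :=
  ⟨⟨e.toPartialEquiv, e.open_source, e.open_target, he, he_symm⟩, hx, hf⟩

theorem exists_partialDiffeomorph_source_subset {f : M → N} {x : M}
    (hf : IsLocalDiffeomorphAt I J n f x) {s : Set M} (hs : s ∈ 𝓝 x) :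
    ∃ Φ : PartialDiffeomorph I J M N n, x ∈ Φ.source ∧ Φ.source ⊆ s ∧ EqOn f Φ Φ.source := by
  obtain ⟨Φ, hx, hΦ⟩ := hf
  let e := Φ.toOpenPartialHomeomorph.restrOpen (interior s) isOpen_interior
  exact ⟨⟨e.toPartialEquiv, e.open_source, e.open_target,
    Φ.contMDiffOn_toFun.mono inter_subset_left, Φ.contMDiffOn_invFun.mono inter_subset_left⟩,
    ⟨hx, mem_interior_iff_mem_nhds.2 hs⟩, fun y hy => interior_subset hy.2, fun y hy => hΦ hy.1⟩

theorem isLocalDiffeomorphAt_congr {f g : M → N} {x : M} (hf : IsLocalDiffeomorphAt I J n f x)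
    (h : f =ᶠ[𝓝 x] g) : IsLocalDiffeomorphAt I J n g x := by
  obtain ⟨Φ, hx, hsub, hΦ⟩ := exists_partialDiffeomorph_source_subset hf h
  exact ⟨Φ, hx, fun y hy => (hsub hy).symm.trans (hΦ hy)⟩

theorem map_nhds_eq_of_isLocalDiffeomorphAt {f : M → N} {x : M}
    (hf : IsLocalDiffeomorphAt I J n f x) : map f (𝓝 x) = 𝓝 (f x) := by
  obtain ⟨Φ, hx, hΦ⟩ := hf
  rw [map_congr (hΦ.eventuallyEq_of_mem (Φ.open_source.mem_nhds hx)), hΦ hx]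
  exact Φ.toOpenPartialHomeomorph.map_nhds_eq hx

theorem isLocalDiffeomorph_of_comp {E' H' M' : Type*} [NormedAddCommGroup E'] [NormedSpace 𝕜 E']
    [TopologicalSpace H'] {I' : ModelWithCorners 𝕜 E' H'} [TopologicalSpace M']
    [ChartedSpace H' M'] {f : M → N} {g : M' → M} (hg : IsLocalDiffeomorph I' I n g)
    (hs : Function.Surjective g) (hfg : IsLocalDiffeomorph I' J n (f ∘ g)) :
    IsLocalDiffeomorph I J n f := by
  intro y
  obtain ⟨x, rfl⟩ := hs y
  have hfg_inv : IsLocalDiffeomorphAt I' J n (f ∘ g) ((hg x).localInverse (g x)) := by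
    rw [(hg x).localInverse_left_inv (hg x).localInverse_mem_target]
    exact hfg x
  refine isLocalDiffeomorphAt_congr
    ((hg x).localInverse_isLocalDiffeomorphAt.comp _ _ hfg_inv) ?_
  filter_upwards [(hg x).localInverse_eventuallyEq_right] with z hz using congrArg f hz

variable {e : OpenPartialHomeomorph M H}

theorem isLocalDiffeomorphAt_of_mem_maximalAtlas (he : e ∈ IsManifold.maximalAtlas I n M) {x : M}
    (hx : x ∈ e.source) : IsLocalDiffeomorphAt I I n e x :=
  isLocalDiffeomorphAt_of_eqOn (contMDiffOn_of_mem_maximalAtlas he)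
    (contMDiffOn_symm_of_mem_maximalAtlas he) hx fun _ _ => rfl

theorem isLocalDiffeomorphAt_symm_of_mem_maximalAtlas (he : e ∈ IsManifold.maximalAtlas I n M)
    {y : H} (hy : y ∈ e.target) : IsLocalDiffeomorphAt I I n e.symm y :=
  isLocalDiffeomorphAt_of_eqOn (e := e.symm) (contMDiffOn_symm_of_mem_maximalAtlas he)
    (by simpa using contMDiffOn_of_mem_maximalAtlas he) hy fun _ _ => rfl

end LocalDiffeomorph

section InverseFunction

variable {E F : Type*} [NormedAddCommGroup E] [NormedSpace ℝ E] [CompleteSpace E]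
  [NormedAddCommGroup F] [NormedSpace ℝ F]

theorem isLocalDiffeomorphAt_of_isInvertible_fderiv {n : WithTop ℕ∞} (hn : n ≠ 0) {f : E → F}
    {a : E} (hf : ∀ᶠ b in 𝓝 a, ContDiffAt ℝ n f b) (hf' : (fderiv ℝ f a).IsInvertible) :
    IsLocalDiffeomorphAt 𝓘(ℝ, E) 𝓘(ℝ, F) n f a := by
  have hinv : ∀ᶠ b in 𝓝 a, (fderiv ℝ f b).IsInvertible :=
    (hf.self_of_nhds.continuousAt_fderiv hn).eventually
      (ContinuousLinearEquiv.isOpen.mem_nhds hf')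
  obtain ⟨s, hs, hso, has⟩ := eventually_nhds_iff.1 (hf.and hinv)
  have hderiv : ∀ b ∈ s, ∃ A : E ≃L[ℝ] F, HasFDerivAt f (A : E →L[ℝ] F) b := fun b hb => by
    obtain ⟨A, hA⟩ := (hs b hb).2
    exact ⟨A, hA ▸ ((hs b hb).1.differentiableAt hn).hasFDerivAt⟩
  obtain ⟨A, hA⟩ := hderiv a has
  let e := (hf.self_of_nhds.toOpenPartialHomeomorph f hA hn).restrOpen s hso
  refine isLocalDiffeomorphAt_of_eqOn (e := e) ?_ ?_
    ⟨hf.self_of_nhds.mem_toOpenPartialHomeomorph_source hA hn, has⟩ fun _ _ => rfl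
  · exact contMDiffOn_iff_contDiffOn.2 fun b hb => (hs b hb.2).1.contDiffWithinAt
  · refine contMDiffOn_iff_contDiffOn.2 fun c hc => ?_
    have hb : e.symm c ∈ s := (e.map_target hc).2
    obtain ⟨B, hB⟩ := hderiv _ hb
    exact (e.contDiffAt_symm hc hB (hs _ hb).1).contDiffWithinAt

end InverseFunction

section Chart

variable {𝕜 E F N : Type*} [NontriviallyNormedField 𝕜] [NormedAddCommGroup E] [NormedSpace 𝕜 E]
  [NormedAddCommGroup F] [NormedSpace 𝕜 F] [TopologicalSpace N] [ChartedSpace E N] {f : N → F}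
  {φ : OpenPartialHomeomorph N E} {b : E}

theorem fderiv_comp_symm_apply (hφ : φ.MDifferentiable 𝓘(𝕜, E) 𝓘(𝕜, E)) (hb : b ∈ φ.target)
    (hf : MDifferentiableAt 𝓘(𝕜, E) 𝓘(𝕜, F) f (φ.symm b)) (v : E) :
    fderiv 𝕜 (f ∘ φ.symm) b v =
      mfderiv 𝓘(𝕜, E) 𝓘(𝕜, F) f (φ.symm b) (mfderiv 𝓘(𝕜, E) 𝓘(𝕜, E) φ.symm b v) := by
  rw [← mfderiv_eq_fderiv, mfderiv_comp b hf (hφ.symm.mdifferentiableAt hb)]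
  rfl

theorem injective_fderiv_comp_symm (hφ : φ.MDifferentiable 𝓘(𝕜, E) 𝓘(𝕜, E)) (hb : b ∈ φ.target)
    (hf : MDifferentiableAt 𝓘(𝕜, E) 𝓘(𝕜, F) f (φ.symm b))
    (hinj : Function.Injective (mfderiv 𝓘(𝕜, E) 𝓘(𝕜, F) f (φ.symm b))) :
    Function.Injective (fderiv 𝕜 (f ∘ φ.symm) b) := fun v w hvw =>
  hφ.symm.mfderiv_injective hb <| hinj <| (fderiv_comp_symm_apply hφ hb hf v).symm.trans <|
    hvw.trans (fderiv_comp_symm_apply hφ hb hf w)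

theorem range_fderiv_comp_symm (hφ : φ.MDifferentiable 𝓘(𝕜, E) 𝓘(𝕜, E)) (hb : b ∈ φ.target)
    (hf : MDifferentiableAt 𝓘(𝕜, E) 𝓘(𝕜, F) f (φ.symm b)) :
    (fderiv 𝕜 (f ∘ φ.symm) b).range = (mfderiv 𝓘(𝕜, E) 𝓘(𝕜, F) f (φ.symm b)).range := by
  ext w
  constructor
  · rintro ⟨v, rfl⟩
    exact ⟨_, (fderiv_comp_symm_apply hφ hb hf v).symm⟩
  · rintro ⟨t, rfl⟩
    obtain ⟨v, rfl⟩ := hφ.symm.mfderiv_surjective hb t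
    exact ⟨v, fderiv_comp_symm_apply hφ hb hf v⟩

end Chart

section ConstantRange

variable {V : Type*} [NormedAddCommGroup V] [InnerProductSpace ℝ V] [FiniteDimensional ℝ V]
  (W : Submodule ℝ V)

theorem eventually_sub_mem_of_range_fderiv_le {E : Type*} [NormedAddCommGroup E] [NormedSpace ℝ E]
    {f : E → V} {a : E}
    (hf : ∀ᶠ b in 𝓝 a, DifferentiableAt ℝ f b ∧ (fderiv ℝ f b).range ≤ W) :
    ∀ᶠ b in 𝓝 a, f b - f a ∈ W := by
  obtain ⟨r, hr, hball⟩ := Metric.eventually_nhds_iff_ball.1 hf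
  have hderiv : ∀ b ∈ Metric.ball a r,
      HasFDerivAt (fun b => Wᗮ.starProjection (f b)) (0 : E →L[ℝ] V) b := fun b hb => by
    have := Wᗮ.starProjection.hasFDerivAt.comp b (hball b hb).1.hasFDerivAt
    convert! this using 1
    ext v
    exact ((Submodule.starProjection_apply_eq_zero_iff _).2
      (Submodule.le_orthogonal_orthogonal _ ((hball b hb).2 ⟨v, rfl⟩))).symm
  filter_upwards [Metric.ball_mem_nhds a hr] with b hb
  have hconst := Metric.isOpen_ball.is_const_of_fderiv_eq_zero (convex_ball a r).isPreconnected
    (fun c hc => (hderiv c hc).differentiableAt.differentiableWithinAt)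
    (fun c hc => (hderiv c hc).fderiv) hb (Metric.mem_ball_self hr)
  rw [← W.orthogonal_orthogonal, ← Submodule.starProjection_apply_eq_zero_iff, map_sub, sub_eq_zero]
  exact hconst

variable {E : Type*} [NormedAddCommGroup E] [NormedSpace ℝ E] [CompleteSpace E]

theorem exists_isLocalDiffeomorphAt_of_range_fderiv_eq {f : E → V} {a : E}
    (hf : ∀ᶠ b in 𝓝 a, ContDiffAt ℝ ∞ f b) (hinj : Function.Injective (fderiv ℝ f a))
    (hrange : ∀ᶠ b in 𝓝 a, (fderiv ℝ f b).range = W) :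
    ∃ g : E → W, IsLocalDiffeomorphAt 𝓘(ℝ, E) 𝓘(ℝ, W) ∞ g a ∧
      ∀ᶠ b in 𝓝 a, (g b : V) = f b - f a := by
  let g : E → W := fun b => W.orthogonalProjectionOnto (f b - f a)
  have hg : ∀ᶠ b in 𝓝 a, ContDiffAt ℝ ∞ g b := hf.mono fun b hb =>
    W.orthogonalProjectionOnto.contDiff.contDiffAt.comp b (hb.sub contDiffAt_const)
  have hg_sub : ∀ᶠ b in 𝓝 a, (g b : V) = f b - f a := by
    filter_upwards [eventually_sub_mem_of_range_fderiv_le W ((hf.and hrange).mono fun b hb =>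
      ⟨hb.1.differentiableAt (by simp), hb.2.le⟩)] with b hb
    exact Submodule.starProjection_eq_self_iff.2 hb
  have hg' : ∀ v, (fderiv ℝ g a v : V) = fderiv ℝ f a v := fun v => by
    have hcoe := W.subtypeL.hasFDerivAt.comp a
      (hg.self_of_nhds.differentiableAt (by simp)).hasFDerivAt
    have hsub := ((hf.self_of_nhds.differentiableAt (by simp)).hasFDerivAt.sub_const
      (f a)).congr_of_eventuallyEq hg_sub
    exact congrArg (fun A : E →L[ℝ] V => A v) (hcoe.unique hsub)
  refine ⟨g, isLocalDiffeomorphAt_of_isInvertible_fderiv (by simp) hg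
    ⟨ContinuousLinearEquiv.ofBijective (fderiv ℝ g a) (LinearMap.ker_eq_bot.2 fun v w hvw => ?_)
      (LinearMap.range_eq_top.2 fun w => ?_), rfl⟩, hg_sub⟩
  · exact hinj ((hg' v).symm.trans ((congrArg Subtype.val hvw).trans (hg' w)))
  · obtain ⟨v, hv⟩ := hrange.self_of_nhds.ge w.2
    exact ⟨v, Subtype.ext ((hg' v).trans hv)⟩

theorem exists_isLocalDiffeomorphAt_of_range_mfderiv_eq {N : Type*} [TopologicalSpace N]
    [ChartedSpace E N] [IsManifold 𝓘(ℝ, E) ∞ N] {f : N → V} {p : N}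
    (hf : ∀ᶠ q in 𝓝 p, ContMDiffAt 𝓘(ℝ, E) 𝓘(ℝ, V) ∞ f q)
    (hinj : Function.Injective (mfderiv 𝓘(ℝ, E) 𝓘(ℝ, V) f p))
    (hrange : ∀ᶠ q in 𝓝 p, (mfderiv 𝓘(ℝ, E) 𝓘(ℝ, V) f q).range = W) :
    ∃ g : N → W, IsLocalDiffeomorphAt 𝓘(ℝ, E) 𝓘(ℝ, W) ∞ g p ∧
      ∀ᶠ q in 𝓝 p, (g q : V) = f q - f p := by
  have : IsManifold 𝓘(ℝ, E) 1 N := IsManifold.of_le (n := ∞) (by simp)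
  set φ := chartAt E p
  have hp : p ∈ φ.source := mem_chart_source E p
  have hφ : φ ∈ IsManifold.maximalAtlas 𝓘(ℝ, E) ∞ N := IsManifold.chart_mem_maximalAtlas p
  have hφd : φ.MDifferentiable 𝓘(ℝ, E) 𝓘(ℝ, E) := mdifferentiable_chart p
  have htendsto : Tendsto φ.symm (𝓝 (φ p)) (𝓝 p) := φ.tendsto_symm hp
  have htarget : φ.target ∈ 𝓝 (φ p) := φ.open_target.mem_nhds (φ.map_source hp)
  have hcontDiff : ∀ᶠ b in 𝓝 (φ p), ContDiffAt ℝ ∞ (f ∘ φ.symm) b := by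
    filter_upwards [htendsto.eventually hf, htarget] with b hb hbt
    exact (hb.comp b (contMDiffOn_symm_of_mem_maximalAtlas hφ |>.contMDiffAt
      (φ.open_target.mem_nhds hbt))).contDiffAt
  have hinj_symm : Function.Injective (fderiv ℝ (f ∘ φ.symm) (φ p)) :=
    injective_fderiv_comp_symm hφd (φ.map_source hp)
      ((htendsto.eventually hf).self_of_nhds.mdifferentiableAt (by simp))
      (by rwa [φ.left_inv hp])
  have hrange_symm : ∀ᶠ b in 𝓝 (φ p), (fderiv ℝ (f ∘ φ.symm) b).range = W := by
    filter_upwards [htendsto.eventually hf, htarget, htendsto.eventually hrange] with b hb hbt hbr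
    rw [range_fderiv_comp_symm hφd hbt (hb.mdifferentiableAt (by simp)), hbr]
  obtain ⟨g, hg, hgf⟩ :=
    exists_isLocalDiffeomorphAt_of_range_fderiv_eq W hcontDiff hinj_symm hrange_symm
  refine ⟨g ∘ φ, (isLocalDiffeomorphAt_of_mem_maximalAtlas hφ hp).comp _ _ hg, ?_⟩
  filter_upwards [(φ.continuousAt hp).eventually hgf, φ.open_source.mem_nhds hp] with q hq hqs
  simpa only [Function.comp_apply, φ.left_inv hqs, φ.left_inv hp] using hq

end ConstantRange

/-! ## Affine spaces as manifolds -/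

section AffineManifold

variable {V P V' P' : Type*} [NormedAddCommGroup V] [InnerProductSpace ℝ V]
  [MetricSpace P] [NormedAddTorsor V P] [NormedAddCommGroup V'] [InnerProductSpace ℝ V']
  [MetricSpace P'] [NormedAddTorsor V' P']

instance affineIsManifold : IsManifold 𝓘(ℝ, V) ∞ P :=
  OpenPartialHomeomorph.isManifold_singleton _ rfl

theorem contMDiff_vsub_const (x : P) :
    ContMDiff 𝓘(ℝ, V) 𝓘(ℝ, V) ∞ (fun y : P => y -ᵥ x) := by
  have hchart : ContMDiff 𝓘(ℝ, V) 𝓘(ℝ, V) ∞ (chartAt V x) :=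
    contMDiffOn_univ.1 (contMDiffOn_chart (I := 𝓘(ℝ, V)) (n := ∞) (x := x))
  have hadd : ContMDiff 𝓘(ℝ, V) 𝓘(ℝ, V) ∞ (fun v : V => v + ((Classical.arbitrary P : P) -ᵥ x)) :=
    (contDiff_id.add contDiff_const).contMDiff
  convert! hadd.comp hchart using 1
  ext y
  simp

theorem contMDiff_vadd_const (x : P) :
    ContMDiff 𝓘(ℝ, V) 𝓘(ℝ, V) ∞ (fun v : V => v +ᵥ x) := by
  have hchart : ContMDiff 𝓘(ℝ, V) 𝓘(ℝ, V) ∞ (chartAt V x).symm :=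
    contMDiffOn_univ.1 (contMDiffOn_chart_symm (I := 𝓘(ℝ, V)) (n := ∞) (x := x))
  have hadd : ContMDiff 𝓘(ℝ, V) 𝓘(ℝ, V) ∞ (fun v : V => v + (x -ᵥ (Classical.arbitrary P : P))) :=
    (contDiff_id.add contDiff_const).contMDiff
  convert! hchart.comp hadd using 1
  ext v
  simp [add_vadd]

/-- The identification of the vector space with the affine space given by the origin `x`. -/
def vaddConstDiffeomorph (x : P) : Diffeomorph 𝓘(ℝ, V) 𝓘(ℝ, V) V P ∞ where
  toEquiv := Equiv.vaddConst x
  contMDiff_toFun := contMDiff_vadd_const x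
  contMDiff_invFun := contMDiff_vsub_const x

theorem hasMFDerivAt_vsub_const (x y : P) :
    HasMFDerivAt 𝓘(ℝ, V) 𝓘(ℝ, V) (fun z : P => z -ᵥ x) y (ContinuousLinearMap.id ℝ V) := by
  refine ⟨(contMDiff_vsub_const x).continuous.continuousAt, ?_⟩
  have hwritten : writtenInExtChartAt 𝓘(ℝ, V) 𝓘(ℝ, V) y (fun z : P => z -ᵥ x) =
      fun v : V => v + ((Classical.arbitrary P : P) -ᵥ x) :=
    funext fun v => vadd_vsub_assoc v (Classical.arbitrary P) x
  rw [hwritten]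
  exact ((hasFDerivAt_id _).add_const _).hasFDerivWithinAt

theorem hasMFDerivAt_vadd_const (x : P) (v : V) :
    HasMFDerivAt 𝓘(ℝ, V) 𝓘(ℝ, V) (fun w : V => w +ᵥ x) v (ContinuousLinearMap.id ℝ V) := by
  refine ⟨(contMDiff_vadd_const x).continuous.continuousAt, ?_⟩
  have hwritten : writtenInExtChartAt 𝓘(ℝ, V) 𝓘(ℝ, V) v (fun w : V => w +ᵥ x) =
      fun w : V => w + (x -ᵥ (Classical.arbitrary P : P)) :=
    funext fun w => vadd_vsub_assoc w x (Classical.arbitrary P)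
  rw [hwritten]
  exact ((hasFDerivAt_id _).add_const _).hasFDerivWithinAt

theorem continuousAffineMap_eq_comp (f : P' →ᴬ[ℝ] P) (o : P') :
    f = (fun v : V => v +ᵥ f o) ∘ f.contLinear ∘ fun y : P' => y -ᵥ o := by
  ext y
  simp [-ContinuousAffineMap.map_vadd]

theorem contMDiff_continuousAffineMap (f : P' →ᴬ[ℝ] P) : ContMDiff 𝓘(ℝ, V') 𝓘(ℝ, V) ∞ f := by
  have o : P' := Classical.arbitrary P'
  rw [continuousAffineMap_eq_comp f o]
  exact (contMDiff_vadd_const _).comp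
    (f.contLinear.contDiff.contMDiff.comp (contMDiff_vsub_const o))

theorem hasMFDerivAt_continuousAffineMap (f : P' →ᴬ[ℝ] P) (x : P') :
    HasMFDerivAt 𝓘(ℝ, V') 𝓘(ℝ, V) f x f.contLinear := by
  rw [continuousAffineMap_eq_comp f x]
  exact (hasMFDerivAt_vadd_const _ _).comp x (f.contLinear.hasFDerivAt.hasMFDerivAt.comp x
    (hasMFDerivAt_vsub_const x x))

/-- An isometry between Euclidean affine spaces, as a diffeomorphism. -/
def isometryDiffeomorph (G : P' ≃ᵃⁱ[ℝ] P) : Diffeomorph 𝓘(ℝ, V') 𝓘(ℝ, V) P' P ∞ where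
  toEquiv := G.toEquiv
  contMDiff_toFun := contMDiff_continuousAffineMap G.toContinuousAffineEquiv.toContinuousAffineMap
  contMDiff_invFun :=
    contMDiff_continuousAffineMap G.symm.toContinuousAffineEquiv.toContinuousAffineMap

theorem hasMFDerivAt_isometry (G : P' ≃ᵃⁱ[ℝ] P) (x : P') :
    HasMFDerivAt 𝓘(ℝ, V') 𝓘(ℝ, V) G x ((G.linearIsometryEquiv : V' ≃L[ℝ] V) : V' →L[ℝ] V) :=
  hasMFDerivAt_continuousAffineMap G.toContinuousAffineEquiv.toContinuousAffineMap x

theorem hasMFDerivAt_coe (E' : AffineSubspace ℝ P) [Nonempty E'] (x : E') :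
    HasMFDerivAt 𝓘(ℝ, E'.direction) 𝓘(ℝ, V) ((↑) : E' → P) x E'.direction.subtypeL :=
  hasMFDerivAt_continuousAffineMap E'.subtypeA x

end AffineManifold

/-! ## Flat projections -/

section FlatProjection

variable {V P M : Type*} [NormedAddCommGroup V] [InnerProductSpace ℝ V]
  [MetricSpace P] [NormedAddTorsor V P] [TopologicalSpace M] [ChartedSpace V M]

theorem mfderiv_chartAt_self [IsManifold 𝓘(ℝ, V) 1 M] (x : M) :
    mfderiv 𝓘(ℝ, V) 𝓘(ℝ, V) (chartAt V x) x = ContinuousLinearMap.id ℝ V := by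
  convert! mfderiv_extChartAt_self (I := 𝓘(ℝ, V)) (x := x) using 1

/-- A projection `pr : P → M` onto a flat manifold with the orbits of a group `Γ` of isometries as
fibres, such that the preferred charts of `M` pull back, up to a choice of origin, to elements of
`Γ`. The projections `E → E / Π` and `E → E / L`, as well as the identity of `E`, are such. -/
structure IsFlatProjection (Γ : Subgroup (P ≃ᵃⁱ[ℝ] P)) (pr : P → M) : Prop
    extends IsOpenQuotientMap pr where
  apply_eq_apply_iff {x y : P} : pr x = pr y ↔ ∃ γ ∈ Γ, γ x = y
  exists_chart (x : P) : ∃ γ ∈ Γ, ∃ o : P, ∀ᶠ y in 𝓝 x, chartAt V (pr x) (pr y) = γ y -ᵥ o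

theorem isFlatProjection_id : IsFlatProjection (⊥ : Subgroup (P ≃ᵃⁱ[ℝ] P)) (id : P → P) where
  toIsOpenQuotientMap := .id
  apply_eq_apply_iff := by simp
  exists_chart _ := ⟨1, one_mem _, Classical.arbitrary P, .of_forall fun _ => rfl⟩

namespace IsFlatProjection

variable {Γ : Subgroup (P ≃ᵃⁱ[ℝ] P)} {pr : P → M}

theorem apply_apply_of_mem (h : IsFlatProjection Γ pr) {γ : P ≃ᵃⁱ[ℝ] P} (hγ : γ ∈ Γ) (x : P) :
    pr (γ x) = pr x :=
  (h.apply_eq_apply_iff.2 ⟨γ, hγ, rfl⟩).symm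

theorem exists_isometry (h : IsFlatProjection Γ pr) {e : OpenPartialHomeomorph M V}
    (he : e ∈ flatCharts V M) {x : P} (hx : pr x ∈ e.source) :
    ∃ (γ : P ≃ᵃⁱ[ℝ] P) (o : P), ∀ᶠ y in 𝓝 x, e (pr y) = γ y -ᵥ o := by
  obtain ⟨γ, -, o, hγ⟩ := h.exists_chart x
  set c := chartAt V (pr x)
  have hcx : pr x ∈ c.source := mem_chart_source V (pr x)
  have hce : c.symm ≫ₕ e ∈ euclideanGroupoid V :=
    (mem_maximalAtlas_iff.1 he c (chart_mem_atlas V (pr x))).2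
  obtain ⟨g, hg⟩ := hce.1 (c (pr x)) (by
    simpa only [mfld_simps, hcx, c.map_source hcx, true_and] using hx)
  refine ⟨γ.trans (((AffineIsometryEquiv.vaddConst ℝ o).symm.trans g).trans
    (AffineIsometryEquiv.vaddConst ℝ o)), o, ?_⟩
  have hpr : ContinuousAt pr x := h.continuous.continuousAt
  filter_upwards [hγ, ((c.continuousAt hcx).comp hpr).eventually hg,
    hpr.eventually (c.open_source.mem_nhds hcx)] with y hγy hgy hy
  calc e (pr y) = (c.symm ≫ₕ e) (c (pr y)) := by simp [c.left_inv hy]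
    _ = g (γ y -ᵥ o) := by rw [← hγy]; exact hgy
    _ = _ := by simp

section Smooth

variable [IsManifold 𝓘(ℝ, V) ∞ M]

theorem isLocalDiffeomorph (h : IsFlatProjection Γ pr) :
    IsLocalDiffeomorph 𝓘(ℝ, V) 𝓘(ℝ, V) ∞ pr := by
  intro x
  obtain ⟨γ, -, o, hγ⟩ := h.exists_chart x
  set c := chartAt V (pr x)
  have hcx : pr x ∈ c.source := mem_chart_source V (pr x)
  have hγ_diffeo : IsLocalDiffeomorphAt 𝓘(ℝ, V) 𝓘(ℝ, V) ∞ (fun y => γ y -ᵥ o) x :=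
    ((isometryDiffeomorph γ).trans (vaddConstDiffeomorph o).symm).isLocalDiffeomorph x
  have hc_diffeo : IsLocalDiffeomorphAt 𝓘(ℝ, V) 𝓘(ℝ, V) ∞ c.symm (γ x -ᵥ o) := by
    rw [← hγ.self_of_nhds]
    exact isLocalDiffeomorphAt_symm_of_mem_maximalAtlas
      (IsManifold.chart_mem_maximalAtlas (pr x)) (c.map_source hcx)
  refine isLocalDiffeomorphAt_congr (hγ_diffeo.comp _ _ hc_diffeo) ?_
  filter_upwards [hγ, h.continuous.continuousAt.eventually (c.open_source.mem_nhds hcx)]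
    with y hγy hy
  rw [Function.comp_apply, ← hγy, c.left_inv hy]

theorem mdifferentiableAt (h : IsFlatProjection Γ pr) (x : P) :
    MDifferentiableAt 𝓘(ℝ, V) 𝓘(ℝ, V) pr x :=
  h.isLocalDiffeomorph.mdifferentiable (by simp) x

theorem chartDeriv_mfderiv (h : IsFlatProjection Γ pr) {e : OpenPartialHomeomorph M V}
    {γ : P ≃ᵃⁱ[ℝ] P} {o x : P} (he : MDifferentiableAt 𝓘(ℝ, V) 𝓘(ℝ, V) e (pr x))
    (heγ : ∀ᶠ y in 𝓝 x, e (pr y) = γ y -ᵥ o) (v : V) :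
    chartDeriv e (pr x) (mfderiv 𝓘(ℝ, V) 𝓘(ℝ, V) pr x v) = linearPart γ v := by
  have hleft := he.hasMFDerivAt.comp x (h.mdifferentiableAt x).hasMFDerivAt
  have hright := ((hasMFDerivAt_vsub_const o (γ x)).comp x
    (hasMFDerivAt_isometry γ x)).congr_of_eventuallyEq (f₁ := e ∘ pr) heγ
  exact congrArg (fun A : V →L[ℝ] V => A v) (hasMFDerivAt_unique hleft hright)

theorem exists_mfderiv_eq (h : IsFlatProjection Γ pr) (x : P) :
    ∃ γ ∈ Γ, ∀ v : V, mfderiv 𝓘(ℝ, V) 𝓘(ℝ, V) pr x v = linearPart γ v := by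
  have : IsManifold 𝓘(ℝ, V) 1 M := IsManifold.of_le (n := ∞) (by simp)
  obtain ⟨γ, hγ, o, hx⟩ := h.exists_chart x
  refine ⟨γ, hγ, fun v => ?_⟩
  rw [← h.chartDeriv_mfderiv ((mdifferentiable_chart (I := 𝓘(ℝ, V)) (pr x)).mdifferentiableAt
    (mem_chart_source V (pr x))) hx v, chartDeriv, mfderiv_chartAt_self]
  rfl

theorem flatInner_mfderiv (h : IsFlatProjection Γ pr) (x : P) (v w : V) :
    flatInner (mfderiv 𝓘(ℝ, V) 𝓘(ℝ, V) pr x v) (mfderiv 𝓘(ℝ, V) 𝓘(ℝ, V) pr x w) =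
      inner ℝ v w := by
  obtain ⟨γ, -, hγ⟩ := h.exists_mfderiv_eq x
  rw [hγ, hγ]
  exact (linearPart γ).inner_map_map v w

end Smooth

end IsFlatProjection

end FlatProjection

section QuotientMap

variable {V P : Type*} [NormedAddCommGroup V] [InnerProductSpace ℝ V] [MetricSpace P]
  [NormedAddTorsor V P] (Γ : Subgroup (P ≃ᵃⁱ[ℝ] P))

theorem quotientMap_eq_iff {x y : P} : quotientMap Γ x = quotientMap Γ y ↔ ∃ γ ∈ Γ, γ x = y := by
  rw [eq_comm, quotientMap, quotientMap, Quotient.eq, orbitRel_apply]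
  exact ⟨fun ⟨γ, hγ⟩ => ⟨γ, γ.2, hγ⟩, fun ⟨γ, hγ, h⟩ => ⟨⟨γ, hγ⟩, h⟩⟩

variable [FiniteDimensional ℝ V] [IsTorsionFreeDiscrete Γ]

theorem isQuotientCoveringMap_quotientMap : IsQuotientCoveringMap (quotientMap Γ) Γ :=
  isQuotientCoveringMap_quotientMk_of_properlyDiscontinuousSMul

theorem exists_chartAt_quotientMap (x : P) : ∃ γ ∈ Γ, ∃ o : P, ∀ᶠ y in 𝓝 x,
    chartAt V (quotientMap Γ x) (quotientMap Γ y) = γ y -ᵥ o := by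
  have hpr := (isQuotientCoveringMap_quotientMap Γ).isCoveringMap.isLocalHomeomorph
  have hright := (Quotient.mk_surjective (s := orbitRel Γ P)).hasRightInverse
  let b : P := hright.choose (quotientMap Γ x)
  obtain ⟨γ, hγ, hγx⟩ := (quotientMap_eq_iff Γ).1 (hright.choose_spec (quotientMap Γ x)).symm
  refine ⟨γ, hγ, Classical.arbitrary P, ?_⟩
  have htarget : ∀ᶠ y in 𝓝 x, γ y ∈ (hpr.localInverseAt b).target := by
    refine γ.continuous.continuousAt.eventually
      ((hpr.localInverseAt b).open_target.mem_nhds ?_)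
    rw [hγx]
    exact hpr.self_mem_localInverseAt_target
  filter_upwards [htarget] with y hy
  have hlift : hpr.localInverseAt b (quotientMap Γ y) = γ y := by
    rw [(quotientMap_eq_iff Γ).2 ⟨γ, hγ, rfl⟩]
    simpa using (hpr.localInverseAt b).right_inv hy
  exact congrArg (· -ᵥ Classical.arbitrary P) hlift

theorem isFlatProjection_quotientMap : IsFlatProjection Γ (quotientMap Γ) where
  toIsOpenQuotientMap := (isQuotientCoveringMap_quotientMap Γ).isOpenQuotientMap
  apply_eq_apply_iff := quotientMap_eq_iff Γ
  exists_chart := exists_chartAt_quotientMap Γ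

theorem isRiemannianCovering_quotientMap : IsRiemannianCovering (V := V) (quotientMap Γ) :=
  have h := isFlatProjection_quotientMap Γ
  ⟨(isQuotientCoveringMap_quotientMap Γ).isCoveringMap, h.surjective, h.isLocalDiffeomorph,
    h.flatInner_mfderiv⟩

end QuotientMap

/-! ## Immersions -/

section Immersion

variable {𝕜 E V F M N : Type*} [NontriviallyNormedField 𝕜] [NormedAddCommGroup E]
  [NormedSpace 𝕜 E] [NormedAddCommGroup V] [NormedSpace 𝕜 V] [NormedAddCommGroup F]
  [NormedSpace 𝕜 F] [TopologicalSpace M] [ChartedSpace E M] [TopologicalSpace N] [ChartedSpace V N]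
  {n : WithTop ℕ∞}

theorem mfderiv_injective_of_isImmersionAtOfComplement {f : M → N} {x : M} (hn : 1 ≤ n)
    (hf : IsImmersionAtOfComplement F 𝓘(𝕜, E) 𝓘(𝕜, V) n f x) :
    Function.Injective (mfderiv 𝓘(𝕜, E) 𝓘(𝕜, V) f x) := by
  set φ := hf.domChart
  set ψ := hf.codChart
  have hφ : φ ∈ IsManifold.maximalAtlas 𝓘(𝕜, E) 1 M :=
    IsManifold.maximalAtlas_subset_of_le hn hf.domChart_mem_maximalAtlas
  have hψ : ψ ∈ IsManifold.maximalAtlas 𝓘(𝕜, V) 1 N :=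
    IsManifold.maximalAtlas_subset_of_le hn hf.codChart_mem_maximalAtlas
  let A : V →L[𝕜] E := (ContinuousLinearMap.fst 𝕜 E F).comp (hf.equiv.symm : V →L[𝕜] E × F)
  have hA : A ∘ ψ ∘ f =ᶠ[𝓝 x] φ := by
    filter_upwards [φ.open_source.mem_nhds hf.mem_domChart_source] with y hy
    have hψf : ψ (f (φ.symm (φ y))) = hf.equiv (φ y, 0) :=
      hf.writtenInCharts (show φ y ∈ (φ.extend 𝓘(𝕜, E)).target by simpa using φ.map_source hy)
    rw [φ.left_inv hy] at hψf
    simp [A, hψf]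
  have hφ_deriv : φ.MDifferentiable 𝓘(𝕜, E) 𝓘(𝕜, E) :=
    ⟨fun y hy => (mdifferentiableAt_of_mem_maximalAtlas hφ hy).mdifferentiableWithinAt,
      fun y hy => (mdifferentiableAt_symm_of_mem_maximalAtlas hφ hy).mdifferentiableWithinAt⟩
  have hcomp := (A.hasMFDerivAt (x := ψ (f x))).comp x
    ((mdifferentiableAt_of_mem_maximalAtlas hψ hf.mem_codChart_source).hasMFDerivAt.comp x
      (hf.contMDiffAt.mdifferentiableAt (one_pos.trans_le hn).ne').hasMFDerivAt)
  have hinj := hφ_deriv.mfderiv_injective hf.mem_domChart_source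
  have hφx := (hφ_deriv.mdifferentiableAt
    hf.mem_domChart_source).hasMFDerivAt.congr_of_eventuallyEq hA
  rw [hasMFDerivAt_unique hφx hcomp] at hinj
  exact Function.Injective.of_comp
    (f := fun v => A (mfderiv 𝓘(𝕜, V) 𝓘(𝕜, V) ψ (f x) v)) hinj

theorem isImmersionAtOfComplement_of_comp_eventuallyEq [IsManifold 𝓘(𝕜, E) n M]
    [IsManifold 𝓘(𝕜, V) n N] {f : M → N} {φ : E → M} {ψ : V → N} {a : E} (B : (E × F) ≃L[𝕜] V)
    (hφ : IsLocalDiffeomorphAt 𝓘(𝕜, E) 𝓘(𝕜, E) n φ a)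
    (hψ : IsLocalDiffeomorphAt 𝓘(𝕜, V) 𝓘(𝕜, V) n ψ (B (a, 0)))
    (hf : ∀ᶠ t in 𝓝 a, f (φ t) = ψ (B (t, 0))) :
    IsImmersionAtOfComplement F 𝓘(𝕜, E) 𝓘(𝕜, V) n f (φ a) := by
  obtain ⟨Ψ, haΨ, hΨ⟩ := hψ
  have hB : Continuous fun t : E => B (t, 0) := by fun_prop
  obtain ⟨Φ, haΦ, hΦ_sub, hΦ⟩ := exists_partialDiffeomorph_source_subset hφ
    (inter_mem hf (hB.continuousAt.preimage_mem_nhds (Ψ.open_source.mem_nhds haΨ)))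
  have hfΦ {t : E} (ht : t ∈ Φ.source) : f (Φ t) = Ψ (B (t, 0)) := by
    rw [← hΦ ht, ← hΨ (hΦ_sub ht).2]
    exact (hΦ_sub ht).1
  rw [hΦ haΦ]
  refine .mk_of_charts B Φ.symm.toOpenPartialHomeomorph Ψ.symm.toOpenPartialHomeomorph
    (Φ.map_source haΦ) ?_
    (OpenPartialHomeomorph.mem_maximalAtlas_of_contMDiffOn _ Φ.contMDiffOn_invFun
      Φ.contMDiffOn_toFun)
    (OpenPartialHomeomorph.mem_maximalAtlas_of_contMDiffOn _ Ψ.contMDiffOn_invFun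
      Ψ.contMDiffOn_toFun) ?_ ?_
  · rw [hfΦ haΦ]
    exact Ψ.map_source haΨ
  · intro q hq
    have hq_source : Φ.symm q ∈ Φ.source := Φ.map_target hq
    have hfq := hfΦ hq_source
    rw [show Φ (Φ.symm q) = q from Φ.right_inv hq] at hfq
    change f q ∈ Ψ.target
    rw [hfq]
    exact Ψ.map_source (hΦ_sub hq_source).2
  · intro t ht
    have ht_source : t ∈ Φ.source := by simpa [OpenPartialHomeomorph.extend] using ht
    change Ψ.symm (f (Φ t)) = B (t, 0)
    rw [hfΦ ht_source]
    exact Ψ.left_inv (hΦ_sub ht_source).2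

end Immersion

namespace Submanifold

variable {V : Type v} {M : Type u} [NormedAddCommGroup V] [InnerProductSpace ℝ V]
  [TopologicalSpace M] [ChartedSpace V M] (N : Submanifold V M)

theorem mdifferentiableAt_incl (p : N.Pts) : MDifferentiableAt (𝓡 N.dim) 𝓘(ℝ, V) N.incl p :=
  N.incl_immersion.contMDiff.mdifferentiable (by simp) p

theorem dincl_injective (p : N.Pts) : Function.Injective (N.dincl p) :=
  mfderiv_injective_of_isImmersionAtOfComplement (by simp)
    (N.incl_immersion.isImmersionOfComplement_complement p)

end Submanifold

/-! ## Parallel distributions -/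

section InvariantSubspace

variable {V P : Type*} [NormedAddCommGroup V] [InnerProductSpace ℝ V] [MetricSpace P]
  [NormedAddTorsor V P]

theorem holonomyGroup_mono {Γ Γ' : Subgroup (P ≃ᵃⁱ[ℝ] P)} (h : Γ' ≤ Γ) :
    holonomyGroup Γ' ≤ holonomyGroup Γ :=
  Subgroup.map_mono h

theorem linearPart_mem_holonomyGroup {Γ : Subgroup (P ≃ᵃⁱ[ℝ] P)} {γ : P ≃ᵃⁱ[ℝ] P} (hγ : γ ∈ Γ) :
    linearPart γ ∈ holonomyGroup Γ :=
  Subgroup.mem_map_of_mem _ hγ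

theorem IsInvariantSubspace.mono {H H' : Subgroup (V ≃ₗᵢ[ℝ] V)} {W : Submodule ℝ V}
    (hW : IsInvariantSubspace H W) (h : H' ≤ H) : IsInvariantSubspace H' W :=
  fun A hA => hW A (h hA)

theorem IsInvariantSubspace.apply_mem_iff {H : Subgroup (V ≃ₗᵢ[ℝ] V)} {W : Submodule ℝ V}
    (hW : IsInvariantSubspace H W) {A : V ≃ₗᵢ[ℝ] V} (hA : A ∈ H) {v : V} : A v ∈ W ↔ v ∈ W := by
  refine ⟨fun hv => ?_, hW A hA v⟩
  simpa [LinearIsometryEquiv.inv_def] using hW A⁻¹ (inv_mem hA) (A v) hv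

end InvariantSubspace

section FlatCharts

variable {V M : Type*} [NormedAddCommGroup V] [InnerProductSpace ℝ V] [TopologicalSpace M]
  [ChartedSpace V M]

theorem euclideanGroupoid_le (n : WithTop ℕ∞) :
    euclideanGroupoid V ≤ contDiffGroupoid n 𝓘(ℝ, V) := by
  refine groupoid_of_pregroupoid_le _ _ fun f s hf => ?_
  suffices ContDiffOn ℝ n f s by simpa [contDiffPregroupoid] using this
  intro x hx
  obtain ⟨g, hg⟩ := hf x hx
  have hg_smooth : ContDiff ℝ n g := g.toContinuousAffineEquiv.toContinuousAffineMap.contDiff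
  exact (hg_smooth.contDiffAt.congr_of_eventuallyEq hg).contDiffWithinAt

theorem mem_maximalAtlas_of_mem_flatCharts {e : OpenPartialHomeomorph M V}
    (he : e ∈ flatCharts V M) (n : WithTop ℕ∞) : e ∈ IsManifold.maximalAtlas 𝓘(ℝ, V) n M :=
  StructureGroupoid.maximalAtlas_mono (euclideanGroupoid_le n) he

end FlatCharts

section ParallelField

variable {V P M : Type*} [NormedAddCommGroup V] [InnerProductSpace ℝ V] [MetricSpace P]
  [NormedAddTorsor V P] [TopologicalSpace M] [ChartedSpace V M]

variable (M) in
/-- The field of tangent subspaces which is given, in all the preferred charts of `M`, by the same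
subspace `W` of the model space. On a quotient of `P` by a group whose linear parts preserve `W`,
it is the distribution induced by the constant field `W` on `P`. -/
def parallelField (W : Submodule ℝ V) : TangentField V M := fun _ => W

namespace IsFlatProjection

variable {Γ : Subgroup (P ≃ᵃⁱ[ℝ] P)} {pr : P → M} [IsManifold 𝓘(ℝ, V) ∞ M] {W : Submodule ℝ V}

theorem isProjectable (h : IsFlatProjection Γ pr) (hW : IsInvariantSubspace (holonomyGroup Γ) W) :
    (constField P W).IsProjectable pr (parallelField M W) := by
  intro x
  obtain ⟨γ, hγ, hpr⟩ := h.exists_mfderiv_eq x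
  have hmem : ∀ v, linearPart γ v ∈ W ↔ v ∈ W :=
    fun _ => hW.apply_mem_iff (linearPart_mem_holonomyGroup hγ)
  refine le_antisymm ?_ fun w hw => ?_
  · rintro _ ⟨v, hv, rfl⟩
    exact (congrArg (· ∈ W) (hpr v)).mpr ((hmem v).2 hv)
  · obtain ⟨v, rfl⟩ := (linearPart γ).surjective w
    exact ⟨v, (hmem v).1 hw, hpr v⟩

theorem inChart_parallelField (h : IsFlatProjection Γ pr)
    (hW : IsInvariantSubspace (holonomyGroup Γ) W) {e : OpenPartialHomeomorph M V}
    {γ : P ≃ᵃⁱ[ℝ] P} {o x : P} (he : MDifferentiableAt 𝓘(ℝ, V) 𝓘(ℝ, V) e (pr x))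
    (heγ : ∀ᶠ y in 𝓝 x, e (pr y) = γ y -ᵥ o) :
    (parallelField M W).inChart e (pr x) = W.map (linearPart γ : V →ₗ[ℝ] V) := by
  rw [TangentField.inChart, ← h.isProjectable hW x]
  ext w
  constructor
  · rintro ⟨_, ⟨v, hv, rfl⟩, rfl⟩
    exact ⟨v, hv, (h.chartDeriv_mfderiv he heγ v).symm⟩
  · rintro ⟨v, hv, rfl⟩
    exact ⟨_, ⟨v, hv, rfl⟩, h.chartDeriv_mfderiv he heγ v⟩

theorem isParallel (h : IsFlatProjection Γ pr) (hW : IsInvariantSubspace (holonomyGroup Γ) W) :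
    (parallelField M W).IsParallel := by
  intro e he m hm
  obtain ⟨x, rfl⟩ := h.surjective m
  obtain ⟨γ, o, heγ⟩ := h.exists_isometry he hm
  have hinChart : ∀ᶠ y in 𝓝 x, (parallelField M W).inChart e (pr y) =
      W.map (linearPart γ : V →ₗ[ℝ] V) := by
    filter_upwards [heγ.eventually_nhds,
      h.continuous.continuousAt.eventually (e.open_source.mem_nhds hm)] with y hy hey
    exact h.inChart_parallelField hW (mdifferentiableAt_of_mem_maximalAtlas
      (mem_maximalAtlas_of_mem_flatCharts he 1) hey) hy
  filter_upwards [h.isOpenMap.image_mem_nhds hinChart]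
  rintro _ ⟨y, hy, rfl⟩
  exact hy.trans hinChart.self_of_nhds.symm

end IsFlatProjection

end ParallelField

/-! ## Integral manifolds of a parallel distribution -/

namespace IsFlatProjection

variable {V : Type v} {P M : Type u} [NormedAddCommGroup V] [InnerProductSpace ℝ V]
  [MetricSpace P] [NormedAddTorsor V P] [TopologicalSpace M] [ChartedSpace V M]
  [IsManifold 𝓘(ℝ, V) ∞ M] {Γ : Subgroup (P ≃ᵃⁱ[ℝ] P)} {pr : P → M}

theorem exists_lift (h : IsFlatProjection Γ pr) {E N : Type*} [NormedAddCommGroup E]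
    [NormedSpace ℝ E] [TopologicalSpace N] [ChartedSpace E N] {f : N → M}
    (hf : ContMDiff 𝓘(ℝ, E) 𝓘(ℝ, V) ∞ f) {p : N} {x : P} (hpx : f p = pr x) :
    ∃ g : N → P, g p = x ∧
      ∀ᶠ q in 𝓝 p, ContMDiffAt 𝓘(ℝ, E) 𝓘(ℝ, V) ∞ g q ∧ pr (g q) = f q := by
  have hx := h.isLocalDiffeomorph x
  refine ⟨hx.localInverse ∘ f, ?_, ?_⟩
  · rw [Function.comp_apply, hpx, hx.localInverse_left_inv hx.localInverse_mem_target]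
  · filter_upwards [hf.continuous.continuousAt.eventually (hx.localInverse_open_source.mem_nhds
      (hpx ▸ hx.localInverse_mem_source))] with q hq
    exact ⟨(hx.localInverse_contMDiffOn.contMDiffAt
      (hx.localInverse_open_source.mem_nhds hq)).comp q hf.contMDiffAt,
      hx.localInverse_right_inv hq⟩

theorem mfderiv_lift_injective (h : IsFlatProjection Γ pr) {N : Submanifold V M} {g : N.Pts → P}
    {q : N.Pts} (hg : MDifferentiableAt (𝓡 N.dim) 𝓘(ℝ, V) g q) (hgq : pr ∘ g =ᶠ[𝓝 q] N.incl) :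
    Function.Injective (mfderiv (𝓡 N.dim) 𝓘(ℝ, V) g q) := by
  have hcomp := ((h.mdifferentiableAt (g q)).hasMFDerivAt.comp q
    hg.hasMFDerivAt).congr_of_eventuallyEq hgq.symm
  have hinj := N.dincl_injective q
  rw [Submanifold.dincl, hcomp.mfderiv] at hinj
  exact Function.Injective.of_comp (f := mfderiv 𝓘(ℝ, V) 𝓘(ℝ, V) pr (g q)) hinj

theorem range_mfderiv_lift (h : IsFlatProjection Γ pr) {W : Submodule ℝ V}
    (hW : IsInvariantSubspace (holonomyGroup Γ) W) {N : Submanifold V M}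
    (hN : N.IsIntegral (parallelField M W)) {g : N.Pts → P} {q : N.Pts}
    (hg : MDifferentiableAt (𝓡 N.dim) 𝓘(ℝ, V) g q) (hgq : pr ∘ g =ᶠ[𝓝 q] N.incl) :
    (mfderiv (𝓡 N.dim) 𝓘(ℝ, V) g q).range = W := by
  obtain ⟨γ, hγ, hpr⟩ := h.exists_mfderiv_eq (g q)
  have hcomp := ((h.mdifferentiableAt (g q)).hasMFDerivAt.comp q
    hg.hasMFDerivAt).congr_of_eventuallyEq hgq.symm
  have hdincl : ∀ t, (N.dincl q t : V) = linearPart γ (mfderiv (𝓡 N.dim) 𝓘(ℝ, V) g q t) :=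
    fun t => (congrArg (fun A : _ →L[ℝ] V => A t) hcomp.mfderiv).trans (hpr _)
  have hmem : ∀ v, linearPart γ v ∈ W ↔ v ∈ W :=
    fun _ => hW.apply_mem_iff (linearPart_mem_holonomyGroup hγ)
  ext w
  constructor
  · rintro ⟨t, rfl⟩
    exact (hmem _).1 ((congrArg (· ∈ W) (hdincl t)).mp ((hN q).le ⟨t, rfl⟩))
  · intro hw
    obtain ⟨t, ht⟩ := (hN q).ge ((hmem w).2 hw)
    exact ⟨t, (linearPart γ).injective ((hdincl t).symm.trans ht)⟩

theorem exists_isLocalDiffeomorphAt_of_isIntegral [FiniteDimensional ℝ V]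
    (h : IsFlatProjection Γ pr) {E' : AffineSubspace ℝ P} [Nonempty E']
    (hW : IsInvariantSubspace (holonomyGroup Γ) E'.direction) {N : Submanifold V M}
    (hN : N.IsIntegral (parallelField M E'.direction)) {p : N.Pts} {x : E'}
    (hpx : N.incl p = pr x) :
    ∃ f : E' → N.Pts, IsLocalDiffeomorphAt 𝓘(ℝ, E'.direction) (𝓡 N.dim) ∞ f x ∧
      ∀ᶠ y in 𝓝 x, N.incl (f y) = pr y := by
  obtain ⟨g, hgx, hg⟩ := h.exists_lift N.incl_immersion.contMDiff hpx
  have hvsub : ∀ {q}, ContMDiffAt (𝓡 N.dim) 𝓘(ℝ, V) ∞ g q →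
      mfderiv (𝓡 N.dim) 𝓘(ℝ, V) (fun q => g q -ᵥ (x : P)) q = mfderiv (𝓡 N.dim) 𝓘(ℝ, V) g q :=
    fun hq => ((hasMFDerivAt_vsub_const _ _).comp _
      (hq.mdifferentiableAt (by simp)).hasMFDerivAt).mfderiv
  obtain ⟨w, hw, hwg⟩ := exists_isLocalDiffeomorphAt_of_range_mfderiv_eq E'.direction
    (f := fun q => g q -ᵥ (x : P))
    (hg.mono fun q hq => (contMDiff_vsub_const (x : P)).contMDiffAt.comp q hq.1)
    (by
      rw [hvsub hg.self_of_nhds.1]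
      exact h.mfderiv_lift_injective (hg.self_of_nhds.1.mdifferentiableAt (by simp))
        (hg.mono fun _ hq => hq.2))
    (by
      filter_upwards [hg.eventually_nhds] with q hq
      rw [hvsub hq.self_of_nhds.1]
      exact h.range_mfderiv_lift hW hN (hq.self_of_nhds.1.mdifferentiableAt (by simp))
        (hq.mono fun _ hr => hr.2))
  have hψ := hw.comp _ _ ((vaddConstDiffeomorph x).isLocalDiffeomorph (w p))
  set ψ : N.Pts → E' := vaddConstDiffeomorph x ∘ w
  have hψg : ∀ᶠ q in 𝓝 p, (ψ q : P) = g q := hwg.mono fun q hq => by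
    change (w q : V) +ᵥ (x : P) = g q
    rw [hq, hgx, vsub_self, sub_zero, vsub_vadd]
  have hψp : ψ p = x := Subtype.ext (hψg.self_of_nhds.trans hgx)
  refine ⟨hψ.localInverse, hψp ▸ hψ.localInverse_isLocalDiffeomorphAt, ?_⟩
  have htendsto : Tendsto hψ.localInverse (𝓝 x) (𝓝 p) := by
    have hcont := hψ.localInverse_isLocalDiffeomorphAt.contMDiffAt.continuousAt
    rwa [ContinuousAt, hψ.localInverse_left_inv hψ.localInverse_mem_target, hψp] at hcont
  filter_upwards [htendsto.eventually (hψg.and hg), hψp ▸ hψ.localInverse_eventuallyEq_right]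
    with y ⟨hyψ, hy⟩ hright
  rw [← hy.2, ← hyψ]
  exact congrArg (fun z : E' => pr z) hright

end IsFlatProjection

/-! ## Restriction to an affine subspace -/

section Restriction

variable {V P : Type*} [NormedAddCommGroup V] [InnerProductSpace ℝ V] [MetricSpace P]
  [NormedAddTorsor V P] {Γ : Subgroup (P ≃ᵃⁱ[ℝ] P)} {E' : AffineSubspace ℝ P}

theorem IsInvariantSubspace.image_eq_of_apply_mem {W : Submodule ℝ V}
    (hW : IsInvariantSubspace (holonomyGroup Γ) W) {γ : P ≃ᵃⁱ[ℝ] P} (hγ : γ ∈ Γ)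
    {E₁ E₂ : AffineSubspace ℝ P} (h₁ : E₁.direction = W) (h₂ : E₂.direction = W) {x : P}
    (hx : x ∈ E₁) (hγx : γ x ∈ E₂) : γ '' (E₁ : Set P) = E₂ := by
  have hmem (y : P) : γ y ∈ E₂ ↔ y ∈ E₁ := by
    rw [← AffineSubspace.vsub_right_mem_direction_iff_mem hγx,
      ← AffineSubspace.vsub_right_mem_direction_iff_mem hx, h₁, h₂, ← γ.map_vsub]
    exact hW.apply_mem_iff (linearPart_mem_holonomyGroup hγ)
  ext z
  rw [← γ.apply_symm_apply z, γ.injective.mem_set_image, SetLike.mem_coe, SetLike.mem_coe, hmem]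

theorem IsInvariantSubspace.mem_stabilizerIn_of_apply_mem
    (hW : IsInvariantSubspace (holonomyGroup Γ) E'.direction) {γ : P ≃ᵃⁱ[ℝ] P} (hγ : γ ∈ Γ)
    {x : P} (hx : x ∈ E') (hγx : γ x ∈ E') : γ ∈ stabilizerIn Γ (E' : Set P) :=
  ⟨hγ, hW.image_eq_of_apply_mem hγ rfl rfl hx hγx⟩

variable [Nonempty E']

variable (Γ E') in
/-- The homomorphism restricting the elements of the stabilizer of an affine subspace `E'` in `Γ` to
isometries of `E'`. -/
noncomputable def restrictHom : stabilizerIn Γ (E' : Set P) →* (E' ≃ᵃⁱ[ℝ] E') where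
  toFun σ :=
    have h : E'.map (σ : P ≃ᵃⁱ[ℝ] P).toAffineIsometry.toAffineMap = E' :=
      SetLike.coe_injective σ.2.2
    (E'.isometryEquivMap (σ : P ≃ᵃⁱ[ℝ] P).toAffineIsometry).trans (AffineIsometryEquiv.ofEq _ _ h)
  map_one' := AffineIsometryEquiv.ext fun _ => rfl
  map_mul' _ _ := AffineIsometryEquiv.ext fun _ => rfl

theorem coe_restrictHom_apply (σ : stabilizerIn Γ (E' : Set P)) (x : E') :
    (restrictHom Γ E' σ x : P) = (σ : P ≃ᵃⁱ[ℝ] P) x := rfl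

variable (Γ E') in
/-- The group of all restrictions to `E'` of elements of its stabilizer in `Γ`: the group `Π'`
corresponding to the leaf through `E'`. -/
noncomputable def restrictedGroup : Subgroup (E' ≃ᵃⁱ[ℝ] E') := (restrictHom Γ E').range

theorem mem_restrictedGroup {g : E' ≃ᵃⁱ[ℝ] E'} : g ∈ restrictedGroup Γ E' ↔
    ∃ σ ∈ stabilizerIn Γ (E' : Set P), ∀ x : E', (g x : P) = σ x := by
  constructor
  · rintro ⟨σ, rfl⟩
    exact ⟨σ, σ.2, coe_restrictHom_apply σ⟩
  · rintro ⟨σ, hσ, h⟩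
    exact ⟨⟨σ, hσ⟩, AffineIsometryEquiv.ext fun x => Subtype.ext (h x).symm⟩

end Restriction

section TorsionFreeDiscrete

variable {V P : Type*} [NormedAddCommGroup V] [InnerProductSpace ℝ V] [MetricSpace P]
  [NormedAddTorsor V P]

theorem discreteTopology_of_displacement {Γ : Subgroup (P ≃ᵃⁱ[ℝ] P)} {x : P} {U : Set P}
    (hU : U ∈ 𝓝 x) (h : ∀ γ ∈ Γ, γ x ∈ U → γ = 1) : DiscreteTopology Γ := by
  have hcont (y : P) : Continuous fun γ : Γ => (γ : P ≃ᵃⁱ[ℝ] P) y :=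
    (continuous_apply y).comp (continuous_induced_dom.comp continuous_subtype_val)
  refine discreteTopology_iff_singleton_mem_nhds.2 fun γ => ?_
  have hγU : (γ : P ≃ᵃⁱ[ℝ] P) '' U ∈ 𝓝 ((γ : P ≃ᵃⁱ[ℝ] P) x) :=
    (γ : P ≃ᵃⁱ[ℝ] P).toHomeomorph.isOpenMap.image_mem_nhds hU
  filter_upwards [(hcont x).continuousAt.preimage_mem_nhds hγU]
  rintro δ ⟨u, hu, huδ : (γ : P ≃ᵃⁱ[ℝ] P) u = (δ : P ≃ᵃⁱ[ℝ] P) x⟩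
  have hδ : (γ⁻¹ * δ : Γ) = 1 := Subtype.ext (h _ (γ⁻¹ * δ).2 (by
    change (γ : P ≃ᵃⁱ[ℝ] P).symm ((δ : P ≃ᵃⁱ[ℝ] P) x) ∈ U
    rwa [← huδ, AffineIsometryEquiv.symm_apply_apply]))
  exact (inv_mul_eq_one.1 hδ).symm

variable [FiniteDimensional ℝ V] {Γ : Subgroup (P ≃ᵃⁱ[ℝ] P)} [IsTorsionFreeDiscrete Γ]

theorem eq_of_apply_eq {γ δ : P ≃ᵃⁱ[ℝ] P} (hγ : γ ∈ Γ) (hδ : δ ∈ Γ) {x : P} (hx : γ x = δ x) :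
    γ = δ :=
  congrArg Subtype.val (IsCancelSMul.right_cancel (⟨γ, hγ⟩ : Γ) ⟨δ, hδ⟩ x hx)

theorem restrictHom_injective (E' : AffineSubspace ℝ P) [Nonempty E'] :
    Function.Injective (restrictHom Γ E') := by
  obtain ⟨x⟩ : Nonempty E' := inferInstance
  exact fun σ τ h => Subtype.ext (eq_of_apply_eq σ.2.1 τ.2.1
    (congrArg (fun g : E' ≃ᵃⁱ[ℝ] E' => (g x : P)) h))

instance isTorsionFreeDiscrete_restrictedGroup (E' : AffineSubspace ℝ P) [Nonempty E'] :
    IsTorsionFreeDiscrete (restrictedGroup Γ E') where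
  discrete := by
    obtain ⟨x⟩ : Nonempty E' := inferInstance
    obtain ⟨U, hU, hΓ⟩ := (isQuotientCoveringMap_quotientMap Γ).disjoint (x : P)
    refine discreteTopology_of_displacement (x := x)
      (continuous_subtype_val.continuousAt.preimage_mem_nhds hU) ?_
    rintro _ ⟨σ, rfl⟩ hσ
    have hσ_one : (⟨σ, σ.2.1⟩ : Γ) = 1 :=
      hΓ _ ⟨(σ : P ≃ᵃⁱ[ℝ] P) x, ⟨x, mem_of_mem_nhds hU, rfl⟩, hσ⟩
    rw [show σ = 1 from Subtype.ext (congrArg (fun γ : Γ => (γ : P ≃ᵃⁱ[ℝ] P)) hσ_one), map_one]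
  torsionFree := by
    rintro _ ⟨σ, rfl⟩ hσ
    have hσ_fin := Submonoid.isOfFinOrder_coe.2
      ((restrictHom_injective (Γ := Γ) E').isOfFinOrder_iff.1 hσ)
    rw [show σ = 1 from Subtype.ext (IsTorsionFreeDiscrete.torsionFree _ σ.2.1 hσ_fin), map_one]

theorem le_of_forall_quotientMap_eq {Γ' : Subgroup (P ≃ᵃⁱ[ℝ] P)}
    (h : ∀ g ∈ Γ', ∀ x, quotientMap Γ (g x) = quotientMap Γ x) : Γ' ≤ Γ := by
  intro g hg
  have : ConnectedSpace P := AddTorsor.connectedSpace V P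
  have o : P := Classical.arbitrary P
  obtain ⟨γ, hγ, hγo⟩ := (quotientMap_eq_iff Γ).1 (h g hg o).symm
  have hγ_lift (x : P) : quotientMap Γ x = quotientMap Γ (γ x) :=
    (quotientMap_eq_iff Γ).2 ⟨γ, hγ, rfl⟩
  have hgγ : (g : P → P) = γ :=
    (isQuotientCoveringMap_quotientMap Γ).isCoveringMap.eq_of_comp_eq g.continuous γ.continuous
      (funext fun x => (h g hg x).trans (hγ_lift x)) o hγo.symm
  rwa [DFunLike.coe_injective hgγ]

end TorsionFreeDiscrete

/-! ## The leaf through an affine subspace -/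

section TransModel

variable {W E Q : Type*} [NormedAddCommGroup W] [NormedSpace ℝ W] [NormedAddCommGroup E]
  [NormedSpace ℝ E] [TopologicalSpace Q] [ChartedSpace W Q]

variable (Q) in
/-- The manifold structure consisting of the charts of `Q` followed by an isomorphism `A` of the
model space. It is needed as submanifolds are modelled on coordinate spaces. -/
abbrev chartedSpaceTransModel (A : W ≃L[ℝ] E) : ChartedSpace E Q where
  atlas := (fun e => e.transHomeomorph A.toHomeomorph) '' atlas W Q
  chartAt x := (chartAt W x).transHomeomorph A.toHomeomorph
  mem_chart_source x := mem_chart_source W x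
  chart_mem_atlas x := ⟨_, chart_mem_atlas W x, rfl⟩

variable [IsManifold 𝓘(ℝ, W) ∞ Q]

theorem isManifold_transModel (A : W ≃L[ℝ] E) :
    letI := chartedSpaceTransModel Q A
    IsManifold 𝓘(ℝ, E) ∞ Q := by
  let := chartedSpaceTransModel Q A
  refine isManifold_of_contDiffOn _ _ _ ?_
  rintro _ _ ⟨e, he, rfl⟩ ⟨e', he', rfl⟩
  have hcoord : ContMDiffOn 𝓘(ℝ, W) 𝓘(ℝ, W) ∞ (e' ∘ e.symm) (e.symm ≫ₕ e').source :=
    (contMDiffOn_of_mem_maximalAtlas (IsManifold.subset_maximalAtlas he')).comp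
      ((contMDiffOn_symm_of_mem_maximalAtlas (IsManifold.subset_maximalAtlas he)).mono
        inter_subset_left) inter_subset_right
  exact (A.contDiff.comp_contDiffOn ((contMDiffOn_iff_contDiffOn.1 hcoord).comp
    A.symm.contDiff.contDiffOn (mapsTo_preimage A.symm _))).congr_mono (fun _ _ => rfl)
    fun _ hx => hx.1

theorem isLocalDiffeomorph_id_transModel (A : W ≃L[ℝ] E) :
    letI := chartedSpaceTransModel Q A
    IsLocalDiffeomorph 𝓘(ℝ, W) 𝓘(ℝ, E) ∞ (id : Q → Q) := by
  let := chartedSpaceTransModel Q A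
  have := isManifold_transModel (Q := Q) A
  intro q
  have hW : IsLocalDiffeomorphAt 𝓘(ℝ, W) 𝓘(ℝ, W) ∞ (chartAt W q) q :=
    isLocalDiffeomorphAt_of_mem_maximalAtlas (IsManifold.chart_mem_maximalAtlas q)
      (mem_chart_source W q)
  have hE : IsLocalDiffeomorphAt 𝓘(ℝ, E) 𝓘(ℝ, E) ∞ (chartAt E q).symm (A (chartAt W q q)) :=
    isLocalDiffeomorphAt_symm_of_mem_maximalAtlas (IsManifold.chart_mem_maximalAtlas q)
      (mem_chart_target E q)
  refine isLocalDiffeomorphAt_congr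
    ((hW.comp _ _ (A.toDiffeomorph.isLocalDiffeomorph _)).comp _ _ hE) ?_
  filter_upwards [(chartAt E q).open_source.mem_nhds (mem_chart_source E q)]
    with y hy using (chartAt E q).left_inv hy

end TransModel

namespace IsFlatProjection

variable {V : Type v} {P M : Type u} [NormedAddCommGroup V] [InnerProductSpace ℝ V]
  [MetricSpace P] [NormedAddTorsor V P] [TopologicalSpace M] [ChartedSpace V M]
  {Γ : Subgroup (P ≃ᵃⁱ[ℝ] P)} {pr : P → M} {E' : AffineSubspace ℝ P} [Nonempty E']

theorem quotientMap_restrictedGroup_eq_iff (h : IsFlatProjection Γ pr)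
    (hW : IsInvariantSubspace (holonomyGroup Γ) E'.direction) {x y : E'} :
    quotientMap (restrictedGroup Γ E') x = quotientMap (restrictedGroup Γ E') y ↔
      pr x = pr y := by
  rw [quotientMap_eq_iff, h.apply_eq_apply_iff]
  constructor
  · rintro ⟨_, ⟨σ, rfl⟩, rfl⟩
    exact ⟨σ, σ.2.1, rfl⟩
  · rintro ⟨γ, hγ, hxy⟩
    have hσ := hW.mem_stabilizerIn_of_apply_mem hγ x.2 (hxy ▸ y.2)
    exact ⟨restrictHom Γ E' ⟨γ, hσ⟩, ⟨_, rfl⟩, Subtype.ext hxy⟩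

/-- The injection `E' / Π' → M` through which the restriction of `pr` to `E'` factors, where `Π'` is
the group of restrictions of elements of the stabilizer of `E'`. -/
noncomputable def leafIncl (h : IsFlatProjection Γ pr)
    (hW : IsInvariantSubspace (holonomyGroup Γ) E'.direction) :
    QuotientSpace (restrictedGroup Γ E') → M :=
  Quotient.lift (fun x : E' => pr x) fun _ _ hxy =>
    (h.quotientMap_restrictedGroup_eq_iff hW).1 (Quotient.sound hxy)

theorem leafIncl_quotientMap (h : IsFlatProjection Γ pr)
    (hW : IsInvariantSubspace (holonomyGroup Γ) E'.direction) (x : E') :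
    h.leafIncl hW (quotientMap (restrictedGroup Γ E') x) = pr x := rfl

theorem leafIncl_injective (h : IsFlatProjection Γ pr)
    (hW : IsInvariantSubspace (holonomyGroup Γ) E'.direction) :
    Function.Injective (h.leafIncl hW) := by
  rintro ⟨x⟩ ⟨y⟩ hxy
  exact (h.quotientMap_restrictedGroup_eq_iff hW).2 hxy

variable [IsManifold 𝓘(ℝ, V) ∞ M]

theorem exists_dincl_mfderiv_eq (h : IsFlatProjection Γ pr) {N : Submanifold V M} {q : E' → N.Pts}
    (hq : ∀ x : E', N.incl (q x) = pr x) {x : E'}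
    (hqx : MDifferentiableAt 𝓘(ℝ, E'.direction) (𝓡 N.dim) q x) :
    ∃ γ ∈ Γ, ∀ v : E'.direction,
      N.dincl (q x) (mfderiv 𝓘(ℝ, E'.direction) (𝓡 N.dim) q x v) = linearPart γ (v : V) := by
  obtain ⟨γ, hγ, hpr⟩ := h.exists_mfderiv_eq (x : P)
  have hincl := (N.mdifferentiableAt_incl (q x)).hasMFDerivAt.comp x hqx.hasMFDerivAt
  have hprE' := (h.mdifferentiableAt (x : P)).hasMFDerivAt.comp x (hasMFDerivAt_coe E' x)
  rw [show N.incl ∘ q = pr ∘ fun y : E' => (y : P) from funext hq] at hincl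
  exact ⟨γ, hγ, fun v => (congrArg (fun A : E'.direction →L[ℝ] V => A v)
    (hasMFDerivAt_unique hincl hprE')).trans (hpr v)⟩

theorem isIntegral_of_lift (h : IsFlatProjection Γ pr)
    (hW : IsInvariantSubspace (holonomyGroup Γ) E'.direction) {N : Submanifold V M}
    {q : E' → N.Pts} (hq : ∀ x : E', N.incl (q x) = pr x) (hq_surj : Function.Surjective q)
    (hq_diffeo : IsLocalDiffeomorph 𝓘(ℝ, E'.direction) (𝓡 N.dim) ∞ q) :
    N.IsIntegral (parallelField M E'.direction) := by
  intro p
  obtain ⟨x, rfl⟩ := hq_surj p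
  obtain ⟨γ, hγ, hd⟩ := h.exists_dincl_mfderiv_eq hq (hq_diffeo.mdifferentiable (by simp) x)
  have hsurj : Function.Surjective (mfderiv 𝓘(ℝ, E'.direction) (𝓡 N.dim) q x) :=
    ((hq_diffeo x).mfderivToContinuousLinearEquiv (by simp)).surjective
  have hmem (v : V) := hW.apply_mem_iff (linearPart_mem_holonomyGroup hγ) (v := v)
  ext w
  constructor
  · rintro ⟨t, rfl⟩
    obtain ⟨v, rfl⟩ := hsurj t
    exact (congrArg (· ∈ E'.direction) (hd v)).mpr ((hmem _).2 (show E'.direction from v).2)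
  · intro hw
    obtain ⟨v, rfl⟩ := (linearPart γ).surjective w
    exact ⟨_, hd ⟨v, (hmem v).1 hw⟩⟩

variable [FiniteDimensional ℝ V] [IsTorsionFreeDiscrete Γ]

theorem isLocalDiffeomorph_quotientMap_transModel {F : Type*} [NormedAddCommGroup F]
    [NormedSpace ℝ F] (A : V ≃L[ℝ] F) :
    letI := chartedSpaceTransModel (QuotientSpace Γ) A
    IsLocalDiffeomorph 𝓘(ℝ, V) 𝓘(ℝ, F) ∞ (quotientMap Γ) :=
  let := chartedSpaceTransModel (QuotientSpace Γ) A
  fun x => ((isFlatProjection_quotientMap Γ).isLocalDiffeomorph x).comp _ _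
    (isLocalDiffeomorph_id_transModel A _)

theorem isImmersion_leafIncl (h : IsFlatProjection Γ pr)
    (hW : IsInvariantSubspace (holonomyGroup Γ) E'.direction) {F : Type*} [NormedAddCommGroup F]
    [NormedSpace ℝ F] (A : E'.direction ≃L[ℝ] F) :
    letI := chartedSpaceTransModel (QuotientSpace (restrictedGroup Γ E')) A
    IsImmersion 𝓘(ℝ, F) 𝓘(ℝ, V) ∞ (h.leafIncl hW) := by
  let := chartedSpaceTransModel (QuotientSpace (restrictedGroup Γ E')) A
  have := isManifold_transModel (Q := QuotientSpace (restrictedGroup Γ E')) A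
  refine ⟨E'.directionᗮ, inferInstance, inferInstance, ?_⟩
  rintro ⟨x⟩
  let B : (F × E'.directionᗮ) ≃L[ℝ] V :=
    (A.symm.prodCongr (.refl ℝ E'.directionᗮ)).trans (Submodule.prodEquivOfIsCompl E'.direction
      E'.directionᗮ (Submodule.isCompl_orthogonal _)).toContinuousLinearEquiv
  have hB (t : F) : B (t, 0) = A.symm t := by simp [B]
  have hφ : IsLocalDiffeomorphAt 𝓘(ℝ, F) 𝓘(ℝ, F) ∞
      (fun t => quotientMap (restrictedGroup Γ E') (A.symm t +ᵥ x)) 0 :=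
    ((A.symm.toDiffeomorph.trans (vaddConstDiffeomorph x)).isLocalDiffeomorph 0).comp _ _
      (isLocalDiffeomorph_quotientMap_transModel A _)
  have hψ : IsLocalDiffeomorphAt 𝓘(ℝ, V) 𝓘(ℝ, V) ∞ (fun v => pr (v +ᵥ (x : P))) (B (0, 0)) :=
    ((vaddConstDiffeomorph (x : P)).isLocalDiffeomorph _).comp _ _ (h.isLocalDiffeomorph _)
  convert! isImmersionAtOfComplement_of_comp_eventuallyEq (f := h.leafIncl hW) B hφ hψ
    (.of_forall fun t => ?_) using 1
  · rw [map_zero, zero_vadd]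
    rfl
  · rw [hB, leafIncl_quotientMap]
    rfl

/-- The image of an affine subspace `E'` with invariant direction under the projection, as a
submanifold, with the manifold structure of `E' / Π'`. -/
noncomputable def leafSubmanifold (h : IsFlatProjection Γ pr)
    (hW : IsInvariantSubspace (holonomyGroup Γ) E'.direction) : Submanifold V M :=
  let A := (stdOrthonormalBasis ℝ E'.direction).repr.toContinuousLinearEquiv
  have : SecondCountableTopology E' :=
    (Homeomorph.vaddConst (Classical.arbitrary E') : E'.direction ≃ₜ E').symm
      |>.secondCountableTopology
  { Pts := QuotientSpace (restrictedGroup Γ E')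
    dim := Module.finrank ℝ E'.direction
    secondCountable := ContinuousConstSMul.secondCountableTopology
    charted := chartedSpaceTransModel _ A
    smooth := isManifold_transModel A
    incl := h.leafIncl hW
    incl_injective := h.leafIncl_injective hW
    incl_immersion := h.isImmersion_leafIncl hW A }

theorem range_incl_leafSubmanifold (h : IsFlatProjection Γ pr)
    (hW : IsInvariantSubspace (holonomyGroup Γ) E'.direction) :
    range (h.leafSubmanifold hW).incl = pr '' E' := by
  rw [← Subtype.range_coe (s := (E' : Set P)), ← range_comp]
  exact (Quotient.mk_surjective.range_comp (h.leafIncl hW)).symm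

instance connectedSpace_leafSubmanifold (h : IsFlatProjection Γ pr)
    (hW : IsInvariantSubspace (holonomyGroup Γ) E'.direction) :
    ConnectedSpace (h.leafSubmanifold hW).Pts :=
  have : ConnectedSpace E' := AddTorsor.connectedSpace E'.direction E'
  inferInstanceAs (ConnectedSpace (QuotientSpace (restrictedGroup Γ E')))

theorem isIntegral_leafSubmanifold (h : IsFlatProjection Γ pr)
    (hW : IsInvariantSubspace (holonomyGroup Γ) E'.direction) :
    (h.leafSubmanifold hW).IsIntegral (parallelField M E'.direction) :=
  h.isIntegral_of_lift (N := h.leafSubmanifold hW) (q := quotientMap (restrictedGroup Γ E')) hW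
    (fun _ => rfl) Quotient.mk_surjective (isLocalDiffeomorph_quotientMap_transModel _)

end IsFlatProjection

/-! ## Leaves of a parallel distribution -/

namespace IsFlatProjection

variable {V : Type v} {P M : Type u} [NormedAddCommGroup V] [InnerProductSpace ℝ V]
  [MetricSpace P] [NormedAddTorsor V P] [TopologicalSpace M] [ChartedSpace V M]
  {Γ : Subgroup (P ≃ᵃⁱ[ℝ] P)} {pr : P → M} {W : Submodule ℝ V}

theorem exists_isCoset_mem_image (h : IsFlatProjection Γ pr) (W : Submodule ℝ V) (m : M) :
    ∃ E' : AffineSubspace ℝ P, IsCoset W E' ∧ m ∈ pr '' E' := by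
  obtain ⟨x, rfl⟩ := h.surjective m
  have hx : x ∈ AffineSubspace.mk' x W := AffineSubspace.self_mem_mk' x W
  exact ⟨_, ⟨⟨x, hx⟩, AffineSubspace.direction_mk' x W⟩, x, hx, rfl⟩

theorem image_eq_image_of_mem (h : IsFlatProjection Γ pr)
    (hW : IsInvariantSubspace (holonomyGroup Γ) W) {E₁ E₂ : AffineSubspace ℝ P}
    (h₁ : IsCoset W E₁) (h₂ : IsCoset W E₂) {m : M} (hm₁ : m ∈ pr '' E₁) (hm₂ : m ∈ pr '' E₂) :
    pr '' (E₁ : Set P) = pr '' E₂ := by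
  obtain ⟨x, hx, rfl⟩ := hm₁
  obtain ⟨y, hy, hxy⟩ := hm₂
  obtain ⟨γ, hγ, rfl⟩ := h.apply_eq_apply_iff.1 hxy.symm
  rw [← hW.image_eq_of_apply_mem hγ h₁.2 h₂.2 hx hy, image_image]
  exact image_congr fun z _ => (h.apply_apply_of_mem hγ z).symm

variable [FiniteDimensional ℝ V] [IsManifold 𝓘(ℝ, V) ∞ M]

theorem eventually_incl_mem_image (h : IsFlatProjection Γ pr)
    (hW : IsInvariantSubspace (holonomyGroup Γ) W) {N : Submanifold V M}
    (hN : N.IsIntegral (parallelField M W)) {E' : AffineSubspace ℝ P} (hE' : IsCoset W E')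
    {p : N.Pts} (hp : N.incl p ∈ pr '' E') : ∀ᶠ q in 𝓝 p, N.incl q ∈ pr '' E' := by
  obtain ⟨x, hx, hxp⟩ := hp
  obtain rfl := hE'.2
  have : Nonempty E' := ⟨⟨x, hx⟩⟩
  obtain ⟨f, hf, hfpr⟩ := h.exists_isLocalDiffeomorphAt_of_isIntegral hW hN (x := ⟨x, hx⟩) hxp.symm
  have hfx : f ⟨x, hx⟩ = p := N.incl_injective (hfpr.self_of_nhds.trans hxp)
  rw [← hfx, ← map_nhds_eq_of_isLocalDiffeomorphAt hf, eventually_map]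
  exact hfpr.mono fun y hy => ⟨y, y.2, hy.symm⟩

theorem range_incl_subset_image (h : IsFlatProjection Γ pr)
    (hW : IsInvariantSubspace (holonomyGroup Γ) W) {N : Submanifold V M} [ConnectedSpace N.Pts]
    (hN : N.IsIntegral (parallelField M W)) {E' : AffineSubspace ℝ P} (hE' : IsCoset W E')
    {p : N.Pts} (hp : N.incl p ∈ pr '' E') : range N.incl ⊆ pr '' E' := by
  have hclopen : IsClopen {q | N.incl q ∈ pr '' E'} := by
    refine ⟨⟨isOpen_iff_mem_nhds.2 fun q hq => ?_⟩,
      isOpen_iff_mem_nhds.2 fun q hq => h.eventually_incl_mem_image hW hN hE' hq⟩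
    obtain ⟨E₂, hE₂, hqE₂⟩ := h.exists_isCoset_mem_image W (N.incl q)
    filter_upwards [h.eventually_incl_mem_image hW hN hE₂ hqE₂] with r hrE₂ hrE'
    exact hq (h.image_eq_image_of_mem hW hE' hE₂ hrE' hrE₂ ▸ hqE₂)
  rintro _ ⟨q, rfl⟩
  exact (hclopen.eq_univ ⟨p, hp⟩).ge (mem_univ q)

theorem isLeaf_of_range_eq (h : IsFlatProjection Γ pr)
    (hW : IsInvariantSubspace (holonomyGroup Γ) W) {N : Submanifold V M} [ConnectedSpace N.Pts]
    (hN : N.IsIntegral (parallelField M W)) {E' : AffineSubspace ℝ P} (hE' : IsCoset W E')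
    (hr : range N.incl = pr '' E') : N.IsLeaf (parallelField M W) := by
  refine ⟨inferInstance, hN, fun N' _ hN' hle => Subset.antisymm ?_ hle⟩
  obtain ⟨p⟩ : Nonempty N.Pts := inferInstance
  obtain ⟨p', hp'⟩ := hle ⟨p, rfl⟩
  rw [hr]
  exact h.range_incl_subset_image hW hN' hE' (p := p') (hr ▸ hp' ▸ ⟨p, rfl⟩)

variable [IsTorsionFreeDiscrete Γ]

theorem isLeaf_leafSubmanifold (h : IsFlatProjection Γ pr) {E' : AffineSubspace ℝ P} [Nonempty E']
    (hW : IsInvariantSubspace (holonomyGroup Γ) E'.direction) :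
    (h.leafSubmanifold hW).IsLeaf (parallelField M E'.direction) :=
  h.isLeaf_of_range_eq hW (h.isIntegral_leafSubmanifold hW)
    ⟨nonempty_subtype.1 ‹_›, rfl⟩ (h.range_incl_leafSubmanifold hW)

theorem image_mem_leafSets (h : IsFlatProjection Γ pr)
    (hW : IsInvariantSubspace (holonomyGroup Γ) W) {E' : AffineSubspace ℝ P} (hE' : IsCoset W E') :
    pr '' E' ∈ leafSets (parallelField M W) := by
  obtain rfl := hE'.2
  have : Nonempty E' := hE'.1.to_subtype
  exact ⟨_, h.isLeaf_leafSubmanifold hW, h.range_incl_leafSubmanifold hW⟩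

theorem exists_isCoset_of_isLeaf (h : IsFlatProjection Γ pr)
    (hW : IsInvariantSubspace (holonomyGroup Γ) W) {N : Submanifold V M}
    (hN : N.IsLeaf (parallelField M W)) :
    ∃ E' : AffineSubspace ℝ P, IsCoset W E' ∧ range N.incl = pr '' E' := by
  obtain ⟨_, hN_int, hN_max⟩ := hN
  obtain ⟨p⟩ : Nonempty N.Pts := inferInstance
  obtain ⟨E', hE', hp⟩ := h.exists_isCoset_mem_image W (N.incl p)
  obtain ⟨N', ⟨hN'_conn, hN'_int, -⟩, hN'_range⟩ := h.image_mem_leafSets hW hE'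
  have hsub := h.range_incl_subset_image hW hN_int hE' hp
  rw [← hN'_range] at hsub
  exact ⟨E', hE', (hN_max N' hN'_conn hN'_int hsub).symm.trans hN'_range⟩

theorem leafSets_parallelField (h : IsFlatProjection Γ pr)
    (hW : IsInvariantSubspace (holonomyGroup Γ) W) : leafSets (parallelField M W) =
      {S | ∃ E' : AffineSubspace ℝ P, IsCoset W E' ∧ S = pr '' E'} := by
  ext S
  constructor
  · rintro ⟨N, hN, rfl⟩
    exact h.exists_isCoset_of_isLeaf hW hN
  · rintro ⟨E', hE', rfl⟩
    exact h.image_mem_leafSets hW hE'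

theorem isFoliation (h : IsFlatProjection Γ pr)
    (hW : IsInvariantSubspace (holonomyGroup Γ) W) : IsFoliation (parallelField M W) := by
  intro m
  obtain ⟨E', hE', hm⟩ := h.exists_isCoset_mem_image W m
  rw [h.leafSets_parallelField hW]
  refine ⟨pr '' E', ⟨⟨E', hE', rfl⟩, hm⟩, ?_⟩
  rintro _ ⟨⟨E₂, hE₂, rfl⟩, hm₂⟩
  exact h.image_eq_image_of_mem hW hE₂ hE' hm₂ hm

end IsFlatProjection

/-! ## Coverings of the leaves -/

namespace IsFlatProjection

variable {V : Type v} {P M : Type u} [NormedAddCommGroup V] [InnerProductSpace ℝ V]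
  [MetricSpace P] [NormedAddTorsor V P] [TopologicalSpace M] [ChartedSpace V M]
  {Γ : Subgroup (P ≃ᵃⁱ[ℝ] P)} {pr : P → M} {E' : AffineSubspace ℝ P}

theorem exists_surjective_lift_of_range_eq {N : Submanifold V M} (hr : range N.incl = pr '' E') :
    ∃ q : E' → N.Pts, (∀ x : E', N.incl (q x) = pr x) ∧ Function.Surjective q := by
  have hq (x : E') : ∃ p, N.incl p = pr x := hr.ge ⟨x, x.2, rfl⟩
  choose q hq using hq
  refine ⟨q, hq, fun p => ?_⟩
  obtain ⟨x, hx, hxp⟩ := hr.le ⟨p, rfl⟩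
  exact ⟨⟨x, hx⟩, N.incl_injective ((hq _).trans hxp)⟩

variable [FiniteDimensional ℝ V] [IsManifold 𝓘(ℝ, V) ∞ M] [Nonempty E']

theorem isLocalDiffeomorph_of_incl_eq (h : IsFlatProjection Γ pr)
    (hW : IsInvariantSubspace (holonomyGroup Γ) E'.direction) {N : Submanifold V M}
    (hN : N.IsIntegral (parallelField M E'.direction)) {q : E' → N.Pts}
    (hq : ∀ x : E', N.incl (q x) = pr x) :
    IsLocalDiffeomorph 𝓘(ℝ, E'.direction) (𝓡 N.dim) ∞ q := by
  intro x
  obtain ⟨f, hf, hfpr⟩ := h.exists_isLocalDiffeomorphAt_of_isIntegral hW hN (hq x)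
  exact isLocalDiffeomorphAt_congr hf
    (hfpr.mono fun y hy => N.incl_injective (hy.trans (hq y).symm))

theorem isTotallyGeodesic (h : IsFlatProjection Γ pr)
    (hW : IsInvariantSubspace (holonomyGroup Γ) E'.direction) {N : Submanifold V M}
    (hN : N.IsIntegral (parallelField M E'.direction)) (hr : range N.incl = pr '' E') :
    N.IsTotallyGeodesic := by
  have : IsManifold 𝓘(ℝ, V) 1 M := IsManifold.of_le (n := ∞) (by simp)
  obtain ⟨q, hq, hq_surj⟩ := exists_surjective_lift_of_range_eq hr
  have hq_cont : Continuous q := (h.isLocalDiffeomorph_of_incl_eq hW hN hq).contMDiff.continuous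
  intro p e he hpe a ha
  obtain ⟨x, rfl⟩ := hq_surj p
  rw [hq] at hpe
  obtain ⟨γ, o, heγ⟩ := h.exists_isometry he hpe
  have ha' : a ∈ (parallelField M E'.direction).inChart e (pr x) := by
    rw [hN, hq] at ha
    exact ha
  rw [h.inChart_parallelField hW
    (mdifferentiableAt_of_mem_maximalAtlas (mem_maximalAtlas_of_mem_flatCharts he 1) hpe) heγ]
    at ha'
  obtain ⟨w, hw, rfl⟩ := ha'
  have hline : Continuous fun t : ℝ => t • (⟨w, hw⟩ : E'.direction) +ᵥ x := by fun_prop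
  have htendsto : Tendsto (fun t : ℝ => t • w +ᵥ (x : P)) (𝓝 0) (𝓝 (x : P)) := by
    simpa [Function.comp_def] using (continuous_subtype_val.comp hline).tendsto 0
  refine ⟨fun t => q (t • (⟨w, hw⟩ : E'.direction) +ᵥ x), by simp, ?_⟩
  filter_upwards [htendsto.eventually heγ, htendsto.eventually
    (h.continuous.continuousAt.eventually (e.open_source.mem_nhds hpe))] with t hγ ht
  refine ⟨(hq_cont.comp hline).continuousAt, ?_⟩
  have he_line : e (pr (t • w +ᵥ (x : P))) = e (pr x) + t • linearPart γ w := by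
    rw [hγ, heγ.self_of_nhds, γ.map_vadd, map_smul, vadd_vsub_assoc, add_comm]
    rfl
  rw [hq, hq]
  exact (e.left_inv ht).symm.trans (congrArg e.symm he_line)

variable [IsTorsionFreeDiscrete Γ]

theorem isRiemannianCoveringOnto_of_incl_eq (h : IsFlatProjection Γ pr)
    (hW : IsInvariantSubspace (holonomyGroup Γ) E'.direction) {N : Submanifold V M}
    (hN : N.IsIntegral (parallelField M E'.direction)) {q : E' → N.Pts}
    (hq : ∀ x : E', N.incl (q x) = pr x) (hq_surj : Function.Surjective q) :
    IsRiemannianCoveringOnto (W := E'.direction) N q := by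
  have hq_diffeo := h.isLocalDiffeomorph_of_incl_eq hW hN hq
  refine ⟨?_, hq_surj, hq_diffeo, fun x a b => ?_⟩
  · have hq_quot : IsQuotientMap q :=
      hq_diffeo.isOpenMap.isQuotientMap hq_diffeo.contMDiff.continuous hq_surj
    refine (hq_quot.isQuotientCoveringMap_of_properlyDiscontinuousSMul
      (G := restrictedGroup Γ E') fun {x y} => ?_).isCoveringMap
    rw [← N.incl_injective.eq_iff, hq, hq, ← h.quotientMap_restrictedGroup_eq_iff hW]
    exact Quotient.eq''
  · obtain ⟨γ, -, hd⟩ := h.exists_dincl_mfderiv_eq hq (hq_diffeo.mdifferentiable (by simp) x)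
    exact (congrArg₂ (inner ℝ : V → V → ℝ) (hd a) (hd b)).trans
      ((linearPart γ).inner_map_map _ _)

theorem exists_isRiemannianCoveringOnto (h : IsFlatProjection Γ pr)
    (hW : IsInvariantSubspace (holonomyGroup Γ) E'.direction) {N : Submanifold V M}
    (hN : N.IsIntegral (parallelField M E'.direction)) (hr : range N.incl = pr '' E') :
    ∃ q : E' → N.Pts, (∀ x : E', N.incl (q x) = pr x) ∧
      IsRiemannianCoveringOnto (W := E'.direction) N q := by
  obtain ⟨q, hq, hq_surj⟩ := exists_surjective_lift_of_range_eq hr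
  exact ⟨q, hq, h.isRiemannianCoveringOnto_of_incl_eq hW hN hq hq_surj⟩

end IsFlatProjection

/-! ## Compactness of the leaves -/

section LatticeSubspace

variable {V P : Type*} [NormedAddCommGroup V] [InnerProductSpace ℝ V] {L : AddSubgroup V}
  {W : Submodule ℝ V}

theorem IsLatticeSubspace.span_preimage_eq_top (hL : IsLatticeSubspace L W) :
    Submodule.span ℝ {v : W | (v : V) ∈ L} = ⊤ := by
  refine Submodule.map_injective_of_injective W.injective_subtype ?_
  rw [Submodule.map_span, Submodule.map_subtype_top]
  refine (congrArg (Submodule.span ℝ) ?_).trans hL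
  rw [inter_comm]
  exact Subtype.image_preimage_coe (W : Set V) L

theorem IsLatticeSubspace.exists_isCompact [FiniteDimensional ℝ V] (hL : IsLatticeSubspace L W) :
    ∃ K : Set W, IsCompact K ∧ ∀ w : W, ∃ v : W, (v : V) ∈ L ∧ v + w ∈ K := by
  let b := Module.Basis.ofSpan hL.span_preimage_eq_top.ge
  have : Finite ((linearIndepOn_empty ℝ id).extend (empty_subset {v : W | (v : V) ∈ L})) :=
    Module.Finite.finite_basis b
  have hspan : Submodule.span ℤ (range b) ≤ (L.comap W.subtype.toAddMonoidHom).toIntSubmodule :=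
    Submodule.span_le.2 (Module.Basis.ofSpan_subset hL.span_preimage_eq_top.ge)
  refine ⟨_, (ZSpan.fundamentalDomain_isBounded b).isCompact_closure, fun w => ?_⟩
  obtain ⟨v, hv, -⟩ := ZSpan.exist_unique_vadd_mem_fundamentalDomain b w
  exact ⟨v, hspan v.2, subset_closure hv⟩

variable [MetricSpace P] [NormedAddTorsor V P]

theorem IsLatticeSubspace.exists_isCompact_vadd_mem [FiniteDimensional ℝ V]
    {E' : AffineSubspace ℝ P} [Nonempty E'] (hL : IsLatticeSubspace L E'.direction) :
    ∃ K : Set E', IsCompact K ∧ ∀ x : E', ∃ v : E'.direction, (v : V) ∈ L ∧ v +ᵥ x ∈ K := by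
  obtain ⟨K, hK, hLK⟩ := hL.exists_isCompact
  obtain ⟨o⟩ : Nonempty E' := inferInstance
  refine ⟨(· +ᵥ o) '' K, hK.image (Homeomorph.vaddConst o).continuous, fun x => ?_⟩
  obtain ⟨v, hv, hvx⟩ := hLK (x -ᵥ o)
  exact ⟨v, hv, _, hvx, by simp only [add_vadd, vsub_vadd]⟩

end LatticeSubspace

namespace IsFlatProjection

variable {V : Type v} {P M : Type u} [NormedAddCommGroup V] [InnerProductSpace ℝ V]
  [FiniteDimensional ℝ V] [MetricSpace P] [NormedAddTorsor V P] [TopologicalSpace M]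
  [ChartedSpace V M] [IsManifold 𝓘(ℝ, V) ∞ M] {Γ : Subgroup (P ≃ᵃⁱ[ℝ] P)} {pr : P → M}

theorem compactSpace_of_isLatticeSubspace (h : IsFlatProjection Γ pr) {E' : AffineSubspace ℝ P}
    [Nonempty E'] (hW : IsInvariantSubspace (holonomyGroup Γ) E'.direction)
    (hL : IsLatticeSubspace (latticeSubgroup Γ) E'.direction) {N : Submanifold V M}
    (hN : N.IsIntegral (parallelField M E'.direction)) (hr : range N.incl = pr '' E') :
    CompactSpace N.Pts := by
  obtain ⟨q, hq, hq_surj⟩ := exists_surjective_lift_of_range_eq hr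
  have hq_cont : Continuous q := (h.isLocalDiffeomorph_of_incl_eq hW hN hq).contMDiff.continuous
  obtain ⟨K, hK, hLK⟩ := hL.exists_isCompact_vadd_mem
  suffices hqK : q '' K = univ from ⟨hqK ▸ hK.image hq_cont⟩
  refine eq_univ_of_forall fun p => ?_
  obtain ⟨x, rfl⟩ := hq_surj p
  obtain ⟨v, hv, hvx⟩ := hLK x
  refine ⟨_, hvx, N.incl_injective ?_⟩
  rw [hq, hq]
  exact h.apply_apply_of_mem hv (x : P)

theorem compactSpace_and_isTotallyGeodesic_of_isLeaf [IsTorsionFreeDiscrete Γ]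
    (h : IsFlatProjection Γ pr) {W : Submodule ℝ V} (hW : IsInvariantSubspace (holonomyGroup Γ) W)
    (hL : IsLatticeSubspace (latticeSubgroup Γ) W) {N : Submanifold V M}
    (hN : N.IsLeaf (parallelField M W)) : CompactSpace N.Pts ∧ N.IsTotallyGeodesic := by
  obtain ⟨E', hE', hr⟩ := h.exists_isCoset_of_isLeaf hW hN
  obtain rfl := hE'.2
  have : Nonempty E' := hE'.1.to_subtype
  exact ⟨h.compactSpace_of_isLatticeSubspace hW hL hN.2.1 hr, h.isTotallyGeodesic hW hN.2.1 hr⟩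

end IsFlatProjection

/-! ## The Bieberbach group of a leaf -/

theorem isCoveringMap_of_homeomorph {X Y : Type*} [TopologicalSpace X] [TopologicalSpace Y]
    (f : X ≃ₜ Y) : IsCoveringMap f := fun y =>
  IsEvenlyCovered.to_isEvenlyCovered_preimage (I := Unit)
    ⟨inferInstance, univ, mem_univ y, isOpen_univ, isOpen_univ,
      (((Homeomorph.Set.univ X).trans f).trans (Homeomorph.Set.univ Y).symm).trans
        (Homeomorph.prodPUnit _).symm, fun _ => rfl⟩

section LatticeAndHolonomy

variable {V P : Type*} [NormedAddCommGroup V] [InnerProductSpace ℝ V] [MetricSpace P]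
  [NormedAddTorsor V P] {Γ : Subgroup (P ≃ᵃⁱ[ℝ] P)}

theorem latticeSubgroup_translationSubgroup :
    latticeSubgroup (translationSubgroup Γ) = latticeSubgroup Γ :=
  le_antisymm (fun _ hv => translationSubgroup_le Γ hv) fun v hv => ⟨v, hv, rfl⟩

variable {E' : AffineSubspace ℝ P} [Nonempty E']

theorem constVAdd_mem_restrictedGroup {v : E'.direction} (hv : (v : V) ∈ latticeSubgroup Γ) :
    AffineIsometryEquiv.constVAdd ℝ E' v ∈ restrictedGroup Γ E' := by
  refine mem_restrictedGroup.2 ⟨AffineIsometryEquiv.constVAdd ℝ P (v : V), ⟨hv, ?_⟩, fun x => rfl⟩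
  ext z
  refine ⟨?_, fun hz => ⟨-(v : V) +ᵥ z,
    AffineSubspace.vadd_mem_of_mem_direction (neg_mem v.2) hz, vadd_neg_vadd (v : V) z⟩⟩
  rintro ⟨y, hy, rfl⟩
  exact AffineSubspace.vadd_mem_of_mem_direction v.2 hy

theorem coe_linearPart_restrictHom (σ : stabilizerIn Γ (E' : Set P)) (v : E'.direction) :
    (linearPart (restrictHom Γ E' σ) v : V) = linearPart (σ : P ≃ᵃⁱ[ℝ] P) (v : V) := by
  obtain ⟨x⟩ : Nonempty E' := inferInstance
  have hE' := (restrictHom Γ E' σ).map_vadd x v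
  have hP := (σ : P ≃ᵃⁱ[ℝ] P).map_vadd (x : P) (v : V)
  exact vadd_right_cancel (restrictHom Γ E' σ x : P) ((congrArg Subtype.val hE').symm.trans hP)

theorem mem_holonomyGroup_restrictedGroup {A : E'.direction ≃ₗᵢ[ℝ] E'.direction} :
    A ∈ holonomyGroup (restrictedGroup Γ E') ↔ ∃ σ ∈ stabilizerIn Γ (E' : Set P),
      ∀ v : E'.direction, (A v : V) = linearPart σ (v : V) := by
  constructor
  · rintro ⟨_, ⟨σ, rfl⟩, rfl⟩
    exact ⟨σ, σ.2, coe_linearPart_restrictHom σ⟩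
  · rintro ⟨σ, hσ, hA⟩
    refine ⟨_, ⟨⟨σ, hσ⟩, rfl⟩, LinearIsometryEquiv.ext fun v => Subtype.ext ?_⟩
    exact (coe_linearPart_restrictHom ⟨σ, hσ⟩ v).trans (hA v).symm

variable [FiniteDimensional ℝ V] [IsTorsionFreeDiscrete Γ]

theorem isBieberbach_restrictedGroup (hL : IsLatticeSubspace (latticeSubgroup Γ) E'.direction) :
    IsBieberbach (restrictedGroup Γ E') where
  cocompact := by
    obtain ⟨K, hK, hLK⟩ := hL.exists_isCompact_vadd_mem
    refine ⟨K, hK, fun x => ?_⟩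
    obtain ⟨v, hv, hvx⟩ := hLK x
    exact ⟨_, constVAdd_mem_restrictedGroup hv, hvx⟩

end LatticeAndHolonomy

theorem IsFlatProjection.isRiemannianIsometry_of_comp {V W Q : Type*} {M : Type u} {X : Type*}
    [NormedAddCommGroup V] [InnerProductSpace ℝ V] [TopologicalSpace M] [ChartedSpace V M]
    [NormedAddCommGroup W] [InnerProductSpace ℝ W] [MetricSpace Q] [NormedAddTorsor W Q]
    [TopologicalSpace X] [ChartedSpace W X] [IsManifold 𝓘(ℝ, W) ∞ X]
    {Γ : Subgroup (Q ≃ᵃⁱ[ℝ] Q)} {pr : Q → X} (h : IsFlatProjection Γ pr) {N : Submanifold V M}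
    {φ : X → N.Pts} (hφ : IsRiemannianCoveringOnto (W := W) N (φ ∘ pr))
    (hφ_inj : Function.Injective φ) : IsRiemannianIsometry (W := W) N φ := by
  obtain ⟨-, hsurj, hdiffeo, hmetric⟩ := hφ
  have hφ_surj : Function.Surjective φ := hsurj.of_comp
  have hφ_diffeo : IsLocalDiffeomorph 𝓘(ℝ, W) (𝓡 N.dim) ∞ φ :=
    isLocalDiffeomorph_of_comp h.isLocalDiffeomorph h.surjective hdiffeo
  refine ⟨⟨?_, hφ_surj, hφ_diffeo, fun p a b => ?_⟩, hφ_inj⟩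
  · exact isCoveringMap_of_homeomorph (Equiv.toHomeomorphOfContinuousOpen
      (Equiv.ofBijective φ ⟨hφ_inj, hφ_surj⟩) hφ_diffeo.contMDiff.continuous hφ_diffeo.isOpenMap)
  · obtain ⟨x, rfl⟩ := h.surjective p
    have hpr_surj : Function.Surjective (mfderiv 𝓘(ℝ, W) 𝓘(ℝ, W) pr x) :=
      ((h.isLocalDiffeomorph x).mfderivToContinuousLinearEquiv (by simp)).surjective
    obtain ⟨s, rfl⟩ := hpr_surj a
    obtain ⟨t, rfl⟩ := hpr_surj b
    have hchain (r : W) := mfderiv_comp_apply x (hφ_diffeo.mdifferentiable (by simp) _)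
      (h.mdifferentiableAt x) r
    exact (congrArg₂ N.metric (hchain s) (hchain t)).symm.trans
      ((hmetric x s t).trans (h.flatInner_mfderiv x s t).symm)

section Correspondence

variable {V : Type v} {P : Type u} [NormedAddCommGroup V] [InnerProductSpace ℝ V]
  [FiniteDimensional ℝ V] [MetricSpace P] [NormedAddTorsor V P]
  {Γ : Subgroup (P ≃ᵃⁱ[ℝ] P)} [IsTorsionFreeDiscrete Γ] {E' : AffineSubspace ℝ P}
  [Nonempty E']

theorem correspondsTo_restrictedGroup (hW : IsInvariantSubspace (holonomyGroup Γ) E'.direction)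
    (hL : IsLatticeSubspace (latticeSubgroup Γ) E'.direction)
    {N : Submanifold V (QuotientSpace Γ)}
    (hN : N.IsIntegral (parallelField (QuotientSpace Γ) E'.direction))
    (hr : range N.incl = quotientMap Γ '' E') : CorrespondsTo N E' (restrictedGroup Γ E') := by
  have h := isFlatProjection_quotientMap Γ
  obtain ⟨q, hq, hq_cov⟩ := h.exists_isRiemannianCoveringOnto hW hN hr
  have hq_iff {x y : E'} : quotientMap (restrictedGroup Γ E') x =
      quotientMap (restrictedGroup Γ E') y ↔ q x = q y := by
    rw [h.quotientMap_restrictedGroup_eq_iff hW, ← N.incl_injective.eq_iff, hq, hq]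
  let φ : QuotientSpace (restrictedGroup Γ E') → N.Pts :=
    Quotient.lift q fun _ _ hxy => hq_iff.1 (Quotient.sound hxy)
  have hφ_inj : Function.Injective φ := by
    rintro ⟨x⟩ ⟨y⟩ hxy
    exact hq_iff.2 hxy
  exact ⟨isBieberbach_restrictedGroup hL, φ,
    (isFlatProjection_quotientMap _).isRiemannianIsometry_of_comp (φ := φ) hq_cov hφ_inj, hq⟩

theorem CorrespondsTo.eq_restrictedGroup
    (hW : IsInvariantSubspace (holonomyGroup Γ) E'.direction)
    {N : Submanifold V (QuotientSpace Γ)} {Γ' : Subgroup (E' ≃ᵃⁱ[ℝ] E')}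
    (hΓ' : CorrespondsTo N E' Γ') : Γ' = restrictedGroup Γ E' := by
  obtain ⟨_, φ, ⟨-, hφ_inj⟩, hφ⟩ := hΓ'
  have horbit (x y : E') : quotientMap Γ' x = quotientMap Γ' y ↔
      quotientMap (restrictedGroup Γ E') x = quotientMap (restrictedGroup Γ E') y := by
    rw [(isFlatProjection_quotientMap Γ).quotientMap_restrictedGroup_eq_iff hW, ← hφ, ← hφ,
      N.incl_injective.eq_iff, hφ_inj.eq_iff]
  refine le_antisymm (le_of_forall_quotientMap_eq fun g hg x => (horbit _ _).1 ?_)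
    (le_of_forall_quotientMap_eq fun g hg x => (horbit _ _).2 ?_)
  all_goals exact ((quotientMap_eq_iff _).2 ⟨g, hg, rfl⟩).symm

end Correspondence

theorem mainTheorem2_general {V : Type*} {P : Type*} [NormedAddCommGroup V]
    [InnerProductSpace ℝ V] [FiniteDimensional ℝ V] [MetricSpace P] [NormedAddTorsor V P]
    (Γ : Subgroup (P ≃ᵃⁱ[ℝ] P)) [IsTorsionFreeDiscrete Γ] (W : Submodule ℝ V)
    (hW_hol : IsInvariantSubspace (holonomyGroup Γ) W)
    (hW_lat : IsLatticeSubspace (latticeSubgroup Γ) W) :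
    IsFoliation (constField P W) ∧
    leafSets (constField P W) = {S | ∃ E' : AffineSubspace ℝ P, IsCoset W E' ∧ S = (E' : Set P)} ∧
    IsRiemannianCovering (V := V) (quotientMap Γ) ∧
    IsRiemannianCovering (V := V) (quotientMap (translationSubgroup Γ)) ∧
    (∃ D : TangentField V (QuotientSpace (translationSubgroup Γ)),
      (constField P W).IsProjectable (quotientMap (translationSubgroup Γ)) D ∧
      D.IsParallel ∧ IsFoliation D ∧
      (∀ N : Submanifold V (QuotientSpace (translationSubgroup Γ)), N.IsLeaf D →
        CompactSpace N.Pts ∧ N.IsTotallyGeodesic) ∧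
      leafSets D = {S | ∃ E' : AffineSubspace ℝ P, IsCoset W E' ∧
        S = quotientMap (translationSubgroup Γ) '' E'} ∧
      ∀ (E' : AffineSubspace ℝ P) [Nonempty E'], IsCoset W E' →
        ∀ N : Submanifold V (QuotientSpace (translationSubgroup Γ)), N.IsLeaf D →
          range N.incl = quotientMap (translationSubgroup Γ) '' E' →
          ∃ q : E' → N.Pts, (∀ x : E', N.incl (q x) = quotientMap (translationSubgroup Γ) (x : P)) ∧
            IsRiemannianCoveringOnto (W := E'.direction) N q) ∧
    ∃ D : TangentField V (QuotientSpace Γ),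
      (constField P W).IsProjectable (quotientMap Γ) D ∧
      D.IsParallel ∧ IsFoliation D ∧
      (∀ N : Submanifold V (QuotientSpace Γ), N.IsLeaf D →
        CompactSpace N.Pts ∧ N.IsTotallyGeodesic) ∧
      leafSets D = {S | ∃ E' : AffineSubspace ℝ P, IsCoset W E' ∧ S = quotientMap Γ '' E'} ∧
      ∀ (E' : AffineSubspace ℝ P) [Nonempty E'], IsCoset W E' →
        ∀ N : Submanifold V (QuotientSpace Γ), N.IsLeaf D →
          range N.incl = quotientMap Γ '' E' →
          (∃ q : E' → N.Pts, (∀ x : E', N.incl (q x) = quotientMap Γ (x : P)) ∧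
            IsRiemannianCoveringOnto (W := E'.direction) N q) ∧
          (∃ Γ' : Subgroup (E' ≃ᵃⁱ[ℝ] E'), CorrespondsTo N E' Γ') ∧
          ∀ Γ' : Subgroup (E' ≃ᵃⁱ[ℝ] E'), CorrespondsTo N E' Γ' →
            (∀ g : E' ≃ᵃⁱ[ℝ] E',
              g ∈ Γ' ↔ ∃ σ ∈ stabilizerIn Γ (E' : Set P), ∀ x : E', (g x : P) = σ x) ∧
            (∀ A : E'.direction ≃ₗᵢ[ℝ] E'.direction,
              A ∈ holonomyGroup Γ' ↔ ∃ σ ∈ stabilizerIn Γ (E' : Set P),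
                ∀ v : E'.direction, (A v : V) = linearPart σ (v : V)) ∧
            (∀ v : E'.direction,
              v ∈ latticeSubgroup Γ' ↔ AffineIsometryEquiv.constVAdd ℝ E' v ∈ Γ') ∧
            (∀ v : E'.direction, (v : V) ∈ latticeSubgroup Γ → v ∈ latticeSubgroup Γ') ∧
            ∃ ρ : stabilizerIn Γ (E' : Set P) ≃* Γ',
              ∀ (σ : stabilizerIn Γ (E' : Set P)) (x : E'),
                (((ρ σ : E' ≃ᵃⁱ[ℝ] E') x : E') : P) = (σ : P ≃ᵃⁱ[ℝ] P) (x : P) := by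
  have hM := isFlatProjection_quotientMap Γ
  have hT := isFlatProjection_quotientMap (translationSubgroup Γ)
  have hE := isFlatProjection_id (V := V) (P := P)
  have hWT := hW_hol.mono (holonomyGroup_mono (translationSubgroup_le Γ))
  have hWE := hW_hol.mono (holonomyGroup_mono (bot_le (a := Γ)))
  have hW_latT := latticeSubgroup_translationSubgroup (Γ := Γ).symm ▸ hW_lat
  have : IsTorsionFreeDiscrete (⊥ : Subgroup (P ≃ᵃⁱ[ℝ] P)) := .mono (Γ := Γ) ‹_› bot_le
  refine ⟨hE.isFoliation hWE, (hE.leafSets_parallelField hWE).trans (by simp only [image_id]),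
    isRiemannianCovering_quotientMap Γ, isRiemannianCovering_quotientMap _,
    ⟨parallelField _ W, hT.isProjectable hWT, hT.isParallel hWT, hT.isFoliation hWT,
      fun _ => hT.compactSpace_and_isTotallyGeodesic_of_isLeaf hWT hW_latT,
      hT.leafSets_parallelField hWT, ?torusCovering⟩,
    ⟨parallelField _ W, hM.isProjectable hW_hol, hM.isParallel hW_hol, hM.isFoliation hW_hol,
      fun _ => hM.compactSpace_and_isTotallyGeodesic_of_isLeaf hW_hol hW_lat,
      hM.leafSets_parallelField hW_hol, ?leafGroups⟩⟩
  all_goals rintro E' _ ⟨-, rfl⟩ N ⟨-, hN, -⟩ hr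
  case torusCovering => exact hT.exists_isRiemannianCoveringOnto hWT hN hr
  case leafGroups =>
    refine ⟨hM.exists_isRiemannianCoveringOnto hW_hol hN hr,
      ⟨_, correspondsTo_restrictedGroup hW_hol hW_lat hN hr⟩, fun Γ' hΓ' => ?_⟩
    obtain rfl := hΓ'.eq_restrictedGroup hW_hol
    exact ⟨fun _ => mem_restrictedGroup, fun _ => mem_holonomyGroup_restrictedGroup,
      fun _ => Iff.rfl, fun _ => constVAdd_mem_restrictedGroup,
      MonoidHom.ofInjective (restrictHom_injective E'), coe_restrictHom_apply⟩

theorem mainTheorem2 {V : Type*} {P : Type*} [NormedAddCommGroup V] [InnerProductSpace ℝ V]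
    [FiniteDimensional ℝ V] [MetricSpace P] [NormedAddTorsor V P]
    (Γ : Subgroup (P ≃ᵃⁱ[ℝ] P)) [IsBieberbach Γ] (W : Submodule ℝ V)
    (hW_bot : W ≠ ⊥) (hW_top : W ≠ ⊤)
    (hW_hol : IsInvariantSubspace (holonomyGroup Γ) W)
    (hW_lat : IsLatticeSubspace (latticeSubgroup Γ) W) :
    -- the foliation of `E` by the cosets of `W`, and the two covering projections
    IsFoliation (constField P W) ∧
    leafSets (constField P W) = {S | ∃ E' : AffineSubspace ℝ P, IsCoset W E' ∧ S = (E' : Set P)} ∧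
    IsRiemannianCovering (V := V) (quotientMap Γ) ∧
    IsRiemannianCovering (V := V) (quotientMap (translationSubgroup Γ)) ∧
    -- the projected foliation of the torus `E / L`
    (∃ D : TangentField V (QuotientSpace (translationSubgroup Γ)),
      (constField P W).IsProjectable (quotientMap (translationSubgroup Γ)) D ∧
      D.IsParallel ∧ IsFoliation D ∧
      (∀ N : Submanifold V (QuotientSpace (translationSubgroup Γ)), N.IsLeaf D →
        CompactSpace N.Pts ∧ N.IsTotallyGeodesic) ∧
      leafSets D = {S | ∃ E' : AffineSubspace ℝ P, IsCoset W E' ∧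
        S = quotientMap (translationSubgroup Γ) '' E'} ∧
      ∀ (E' : AffineSubspace ℝ P) [Nonempty E'], IsCoset W E' →
        ∀ N : Submanifold V (QuotientSpace (translationSubgroup Γ)), N.IsLeaf D →
          range N.incl = quotientMap (translationSubgroup Γ) '' E' →
          ∃ q : E' → N.Pts, (∀ x : E', N.incl (q x) = quotientMap (translationSubgroup Γ) (x : P)) ∧
            IsRiemannianCoveringOnto (W := E'.direction) N q) ∧
    -- the projected foliation of `M = E / Γ`
    ∃ D : TangentField V (QuotientSpace Γ),
      (constField P W).IsProjectable (quotientMap Γ) D ∧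
      D.IsParallel ∧ IsFoliation D ∧
      (∀ N : Submanifold V (QuotientSpace Γ), N.IsLeaf D →
        CompactSpace N.Pts ∧ N.IsTotallyGeodesic) ∧
      leafSets D = {S | ∃ E' : AffineSubspace ℝ P, IsCoset W E' ∧ S = quotientMap Γ '' E'} ∧
      ∀ (E' : AffineSubspace ℝ P) [Nonempty E'], IsCoset W E' →
        ∀ N : Submanifold V (QuotientSpace Γ), N.IsLeaf D →
          range N.incl = quotientMap Γ '' E' →
          (∃ q : E' → N.Pts, (∀ x : E', N.incl (q x) = quotientMap Γ (x : P)) ∧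
            IsRiemannianCoveringOnto (W := E'.direction) N q) ∧
          -- the Bieberbach group of the leaf
          (∃ Γ' : Subgroup (E' ≃ᵃⁱ[ℝ] E'), CorrespondsTo N E' Γ') ∧
          ∀ Γ' : Subgroup (E' ≃ᵃⁱ[ℝ] E'), CorrespondsTo N E' Γ' →
            (∀ g : E' ≃ᵃⁱ[ℝ] E',
              g ∈ Γ' ↔ ∃ σ ∈ stabilizerIn Γ (E' : Set P), ∀ x : E', (g x : P) = σ x) ∧
            (∀ A : E'.direction ≃ₗᵢ[ℝ] E'.direction,
              A ∈ holonomyGroup Γ' ↔ ∃ σ ∈ stabilizerIn Γ (E' : Set P),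
                ∀ v : E'.direction, (A v : V) = linearPart σ (v : V)) ∧
            (∀ v : E'.direction,
              v ∈ latticeSubgroup Γ' ↔ AffineIsometryEquiv.constVAdd ℝ E' v ∈ Γ') ∧
            (∀ v : E'.direction, (v : V) ∈ latticeSubgroup Γ → v ∈ latticeSubgroup Γ') ∧
            ∃ ρ : stabilizerIn Γ (E' : Set P) ≃* Γ',
              ∀ (σ : stabilizerIn Γ (E' : Set P)) (x : E'),
                (((ρ σ : E' ≃ᵃⁱ[ℝ] E') x : E') : P) = (σ : P ≃ᵃⁱ[ℝ] P) (x : P) :=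
  mainTheorem2_general Γ W hW_hol hW_lat
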